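/- Let $\mathcal K$ be an algebraic number field with ring of integers $\mathcal O$, let $\mathcal O^*$ be the group of units of $\mathcal O$ and $\mathcal O^\times=\mathcal O\setminus\{0\}$. Let $$P_{\mathcal O}=\left\{\begin{pmatrix}1&y\\0&x\end{pmatrix}: y\in\mathcal O,\ x\in\mathcal O^*\right\}\subset P_{\mathcal K}=\left\{\begin{pmatrix}1&y\\0&x\end{pmatrix}: y\in\mathcal K,\ x\in\mathcal K^*\right\}.$$ Every double coset $P_{\mathcal O}\gamma P_{\mathcal O}$ contains finitely many right cosets $P_{\mathcal O}\gamma'$; let $R(\gamma)$ be their number. The Hecke algebra $\mathcal H(P_{\mathcal K},P_{\mathcal O})$ is the unital $*$-algebra of complex-valued $P_{\mathcal O}$-bi-invariant functions on $P_{\mathcal K}$ supported on finitely many double cosets, with product $(f*g)(\gamma)=\sum_{\gamma_1\in P_{\mathcal O}\backslash P_{\mathcal K}}f(\gamma\gamma_1^{-1})g(\gamma_1)$, involution $f^*(\gamma)=\overline{f(\gamma^{-1})}$ and unit the characteristic function of $P_{\mathcal O}$. Write $[S]$ for the characteristic function of $S$. For $a\in\mathcal O^\times$ let $N_a=|\mathcal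 O/a\mathcal O|$ and $$\mu_a=\frac1{\sqrt{N_a}}\left[P_{\mathcal O}\begin{pmatrix}1&0\\0&a\end{pmatrix}P_{\mathcal O}\right],$$ and for $r\in\mathcal K$ let $R(r)=R\begin{pmatrix}1&r\\0&1\end{pmatrix}$ and $$\theta_r=\frac1{R(r)}\left[P_{\mathcal O}\begin{pmatrix}1&r\\0&1\end{pmatrix}P_{\mathcal O}\right];$$ $R(r)$ and $\theta_r$ depend only on the class of $r$ in $\mathcal K/\mathcal O$. For $r\in\mathcal K/\mathcal O$ let $\mathcal O^*_r=\{u\in\mathcal O^*: ur=r\}$, a subgroup of finite index in $\mathcal O^*$. Then the elements $\mu_a$ $(a\in\mathcal O^\times)$ and $\theta_r$ $(r\in\mathcal K/\mathcal O)$ of $\mathcal H(P_{\mathcal K},P_{\mathcal O})$ satisfy the relations * (I.1) $\mu_w=1$ for all $w\in\mathcal O^*$; * (I.2) $\mu_a^*\mu_a=1$ for all $a\in\mathcal O^\times$; * (I.3) $\mu_a\mu_b=\mu_{ab}$ for all $a,b\in\mathcal O^\times$; * (II.1) $\theta_0=1$; * (II.2) $\theta_{wr}=\theta_r=\theta_r^*$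 for all $r\in\mathcal K/\mathcal O$ and $w\in\mathcal O^*$; * (II.3) $\displaystyle\theta_r\theta_s=\frac1{R(r)}\frac1{R(s)}\sum_{u\in\mathcal O^*/\mathcal O^*_r}\ \sum_{v\in\mathcal O^*/\mathcal O^*_s}\theta_{ur+vs}$ for all $r,s\in\mathcal K/\mathcal O$; * (III) $\displaystyle\mu_a\theta_r\mu_a^*=\frac1{N_a}\sum_{b\in\mathcal O/a\mathcal O}\theta_{\frac{r+b}{a}}$ for all $a\in\mathcal O^\times$ and $r\in\mathcal K/\mathcal O$; and $\mathcal H(P_{\mathcal K},P_{\mathcal O})$ is the universal unital $*$-algebra over $\mathbb C$ generated by elements subject to these relations: for every unital $*$-algebra $A$ over $\mathbb C$ and all families $(m_a)_{a\in\mathcal O^\times}$ and $(t_r)_{r\in\mathcal K/\mathcal O}$ in $A$ that satisfy (I.1)–(III) (with $m$, $t$ in place of $\mu$, $\theta$), there is exactly one unital $*$-homomorphism $\varphi:\mathcal H(P_{\mathcal K},P_{\mathcal O})\to A$ with $\varphi(\mu_a)=m_a$ and $\varphi(\theta_r)=t_r$ for all $a$ and $r$. Moreover, the set $\{\mu_a^*\theta_r\mu_b: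 a,b\in\mathcal O^\times,\ r\in\mathcal K/\mathcal O\}$ (a set of elements; different triples $(a,r,b)$ may give the same element) is a linear basis of $\mathcal H(P_{\mathcal K},P_{\mathcal O})$. -/

import Mathlib

open scoped nonZeroDivisors NumberField

/-! ### The Hecke algebra of a Hecke pair -/

namespace HeckePair

universe u

/-- The space `H \ G` of right cosets `H g`. -/
abbrev RightCosets {G : Type u} [Group G] (H : Subgroup G) : Type u :=
  Quotient (QuotientGroup.rightRel H)

/-- The set of right cosets contained in the double coset `H g H`. -/
def rightCosetsIn {G : Type u} [Group G] (H : Subgroup G) (g : G) : Set (RightCosets H) :=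
  Quotient.mk (QuotientGroup.rightRel H) '' DoubleCoset.doubleCoset g H H

/-- The number `R(g)` of right cosets in the double coset `H g H`. -/
noncomputable def numRightCosets {G : Type u} [Group G] (H : Subgroup G) (g : G) : ℕ :=
  (rightCosetsIn H g).ncard

/-- `(G, H)` is a Hecke pair: every double coset contains finitely many right cosets. -/
class IsHeckePair {G : Type u} [Group G] (H : Subgroup G) : Prop where
  finite_rightCosetsIn : ∀ g : G, (rightCosetsIn H g).Finite

/-- The space of complex-valued `H`-bi-invariant functions on `G` supported on finitely many
double cosets. -/
def heckeSubmodule {G : Type u} [Group G] (H : Subgroup G) : Submodule ℂ (G → ℂ) where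
  carrier := {f | (∀ h ∈ H, ∀ k ∈ H, ∀ g, f (h * g * k) = f g) ∧
    ∃ s : Set G, s.Finite ∧ Function.support f ⊆ ⋃ g ∈ s, DoubleCoset.doubleCoset g H H}
  add_mem' := by
    rintro f g ⟨hf, s, hs, hfs⟩ ⟨hg, t, ht, hgt⟩
    refine ⟨fun h hh k hk x => by simp [hf h hh k hk x, hg h hh k hk x], s ∪ t, hs.union ht, ?_⟩
    refine (Function.support_add f g).trans ?_
    rw [Set.biUnion_union]
    exact Set.union_subset_union hfs hgt
  zero_mem' := ⟨fun _ _ _ _ _ => rfl, ∅, Set.finite_empty, by simp⟩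
  smul_mem' := by
    rintro c f ⟨hf, s, hs, hfs⟩
    refine ⟨fun h hh k hk x => by simp [hf h hh k hk x], s, hs, ?_⟩
    exact (Function.support_const_smul_subset c f).trans hfs

/-- The underlying complex vector space of the Hecke algebra `ℋ(G, H)`. -/
def HeckeAlgebra {G : Type u} [Group G] (H : Subgroup G) : Type u := heckeSubmodule H

/-- Convolution: `(f * g)(γ) = ∑_{γ₁ ∈ H \ G} f (γ γ₁⁻¹) g(γ₁)`. -/
noncomputable def conv {G : Type u} [Group G] (H : Subgroup G) (f g : G → ℂ) (γ : G) : ℂ :=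
  ∑ᶠ q : RightCosets H, f (γ * q.out⁻¹) * g q.out

section Aux

variable {G : Type u} [Group G] {H : Subgroup G}

theorem exists_out_eq (γ : G) :
    ∃ h ∈ H, (Quotient.mk (QuotientGroup.rightRel H) γ).out = h * γ := by
  have h1 : (QuotientGroup.rightRel H) (Quotient.mk (QuotientGroup.rightRel H) γ).out γ :=
    Quotient.mk_out γ
  rw [QuotientGroup.rightRel_apply] at h1
  exact ⟨_, H.inv_mem h1, by group⟩

theorem apply_out {F : G → ℂ} (hF : ∀ h ∈ H, ∀ g, F (h * g) = F g) (γ : G) :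
    F (Quotient.mk (QuotientGroup.rightRel H) γ).out = F γ := by
  obtain ⟨h, hh, e⟩ := exists_out_eq (H := H) γ
  rw [e, hF h hh]

/-- Right translation on the space of right cosets. -/
def rightTranslate (H : Subgroup G) (c : G) : RightCosets H ≃ RightCosets H where
  toFun := Quotient.map (· * c) (by
    intro a b hab
    change (QuotientGroup.rightRel H) a b at hab
    change (QuotientGroup.rightRel H) (a * c) (b * c)
    rw [QuotientGroup.rightRel_apply] at hab ⊢
    simpa [mul_assoc] using hab)
  invFun := Quotient.map (· * c⁻¹) (by
    intro a b hab
    change (QuotientGroup.rightRel H) a b at hab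
    change (QuotientGroup.rightRel H) (a * c⁻¹) (b * c⁻¹)
    rw [QuotientGroup.rightRel_apply] at hab ⊢
    simpa [mul_assoc] using hab)
  left_inv := by
    rintro ⟨a⟩
    exact congrArg (Quotient.mk (QuotientGroup.rightRel H)) (mul_inv_cancel_right a c)
  right_inv := by
    rintro ⟨a⟩
    exact congrArg (Quotient.mk (QuotientGroup.rightRel H)) (inv_mul_cancel_right a c)

theorem exists_ne_zero_of_finsum {ι : Type u} {F : ι → ℂ} (h : ∑ᶠ i, F i ≠ 0) :
    ∃ i, F i ≠ 0 := by
  by_contra hc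
  push Not at hc
  exact h (by simp [hc])

theorem finsum_translate {F : G → ℂ} (hF : ∀ h ∈ H, ∀ g, F (h * g) = F g) (c : G) :
    ∑ᶠ q : RightCosets H, F (q.out * c) = ∑ᶠ q : RightCosets H, F q.out := by
  rw [← finsum_comp_equiv (rightTranslate H c) (f := fun q : RightCosets H => F q.out)]
  refine finsum_congr fun q => ?_
  induction q using Quotient.inductionOn with
  | h a =>
    obtain ⟨h, hh, e⟩ := exists_out_eq (H := H) a
    change _ = F (Quotient.mk (QuotientGroup.rightRel H) (a * c)).out
    rw [apply_out hF, e, mul_assoc, hF h hh]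

theorem left_inv_of_mem {f : G → ℂ} (hf : f ∈ heckeSubmodule H) :
    ∀ h ∈ H, ∀ g, f (h * g) = f g := fun h hh g => by
  simpa using hf.1 h hh 1 H.one_mem g

theorem right_inv_of_mem {f : G → ℂ} (hf : f ∈ heckeSubmodule H) :
    ∀ h ∈ H, ∀ g, f (g * h) = f g := fun h hh g => by
  simpa using hf.1 1 H.one_mem h hh g

theorem finite_image_support [IsHeckePair H] {f : G → ℂ} (hf : f ∈ heckeSubmodule H) :
    (Quotient.mk (QuotientGroup.rightRel H) '' Function.support f).Finite := by
  obtain ⟨-, s, hs, hfs⟩ := hf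
  refine Set.Finite.subset (hs.biUnion fun g _ => IsHeckePair.finite_rightCosetsIn (H := H) g) ?_
  rintro _ ⟨x, hx, rfl⟩
  obtain ⟨g, hg, hxg⟩ := Set.mem_iUnion₂.1 (hfs hx)
  exact Set.mem_iUnion₂.2 ⟨g, hg, x, hxg, rfl⟩

theorem finite_support_out [IsHeckePair H] {f : G → ℂ} (hf : f ∈ heckeSubmodule H) :
    (Function.support fun q : RightCosets H => f q.out).Finite := by
  refine (finite_image_support hf).subset fun q hq => ⟨q.out, hq, Quotient.out_eq q⟩

theorem conv_mem [IsHeckePair H] {f g : G → ℂ} (hf : f ∈ heckeSubmodule H)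
    (hg : g ∈ heckeSubmodule H) : conv H f g ∈ heckeSubmodule H := by
  constructor
  · intro h hh k hk γ
    have h1 : conv H f g (h * γ * k) = ∑ᶠ q : RightCosets H, f (γ * k * q.out⁻¹) * g q.out :=
      finsum_congr fun q => by
        rw [mul_assoc h, mul_assoc h, left_inv_of_mem hf h hh]
    rw [h1, ← finsum_translate (F := fun x => f (γ * k * x⁻¹) * g x) ?_ k]
    · refine finsum_congr fun q => ?_
      have : γ * k * (q.out * k)⁻¹ = γ * q.out⁻¹ := by group
      rw [this, right_inv_of_mem hg k hk]
    · intro h' hh' x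
      have : γ * k * (h' * x)⁻¹ = γ * k * x⁻¹ * h'⁻¹ := by group
      simp only [this]
      rw [right_inv_of_mem hf _ (H.inv_mem hh'), left_inv_of_mem hg _ hh']
  · refine ⟨(fun p : RightCosets H × RightCosets H => p.1.out * p.2.out) ''
      ((Quotient.mk (QuotientGroup.rightRel H) '' Function.support f) ×ˢ
        (Function.support fun q : RightCosets H => g q.out)),
      ((finite_image_support hf).prod (finite_support_out hg)).image _, ?_⟩
    intro γ hγ
    obtain ⟨q, hq⟩ := exists_ne_zero_of_finsum hγ
    obtain ⟨h, hh, e⟩ := exists_out_eq (H := H) (γ * q.out⁻¹)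
    refine Set.mem_iUnion₂.2 ⟨_, ⟨(Quotient.mk _ (γ * q.out⁻¹), q),
      ⟨⟨_, left_ne_zero_of_mul hq, rfl⟩, right_ne_zero_of_mul hq⟩, rfl⟩, ?_⟩
    rw [DoubleCoset.mem_doubleCoset]
    refine ⟨h⁻¹, H.inv_mem hh, 1, H.one_mem, ?_⟩
    simp only [e]
    group

theorem conv_assoc [IsHeckePair H] {f g k : G → ℂ} (hf : f ∈ heckeSubmodule H)
    (hg : g ∈ heckeSubmodule H) (hk : k ∈ heckeSubmodule H) :
    conv H (conv H f g) k = conv H f (conv H g k) := by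
  funext γ
  have hL : conv H (conv H f g) k γ =
      ∑ᶠ q : RightCosets H, ∑ᶠ p : RightCosets H, f (γ * p.out⁻¹) * g (p.out * q.out⁻¹) *
        k q.out := by
    refine finsum_congr fun q => ?_
    rw [conv, ← finsum_translate (F := fun x => f (γ * q.out⁻¹ * x⁻¹) * g x) ?_ q.out⁻¹,
      finsum_mul]
    · refine finsum_congr fun p => ?_
      have : γ * q.out⁻¹ * (p.out * q.out⁻¹)⁻¹ = γ * p.out⁻¹ := by group
      rw [this]
    · intro h hh x
      have : γ * q.out⁻¹ * (h * x)⁻¹ = γ * q.out⁻¹ * x⁻¹ * h⁻¹ := by group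
      simp only [this]
      rw [right_inv_of_mem hf _ (H.inv_mem hh), left_inv_of_mem hg _ hh]
  have hR : conv H f (conv H g k) γ =
      ∑ᶠ p : RightCosets H, ∑ᶠ q : RightCosets H, f (γ * p.out⁻¹) * g (p.out * q.out⁻¹) *
        k q.out := by
    refine finsum_congr fun p => ?_
    rw [conv, mul_finsum]
    exact finsum_congr fun q => by ring
  rw [hL, hR]
  set S := (finite_support_out (H := H) hk).toFinset with hS
  have hq : ∀ F : RightCosets H → ℂ, ∑ᶠ q : RightCosets H, F q * k q.out =
      ∑ q ∈ S, F q * k q.out := fun F => by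
    refine finsum_eq_finsetSum_of_support_subset _ fun q hq => ?_
    simpa [hS] using right_ne_zero_of_mul hq
  have hfin : ∀ q : RightCosets H, (Function.support fun p : RightCosets H =>
      f (γ * p.out⁻¹) * g (p.out * q.out⁻¹) * k q.out).Finite := fun q => by
    refine (((finite_image_support hg)).image (rightTranslate H q.out)).subset fun p hp => ?_
    refine ⟨Quotient.mk _ (p.out * q.out⁻¹),
      ⟨_, right_ne_zero_of_mul (left_ne_zero_of_mul hp), rfl⟩, ?_⟩
    change Quotient.mk (QuotientGroup.rightRel H) (p.out * q.out⁻¹ * q.out) = p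
    rw [inv_mul_cancel_right, Quotient.out_eq]
  calc
    _ = ∑ q ∈ S, ∑ᶠ p : RightCosets H, f (γ * p.out⁻¹) * g (p.out * q.out⁻¹) * k q.out := by
      refine finsum_eq_finsetSum_of_support_subset _ fun q hq => ?_
      obtain ⟨p, hp⟩ := exists_ne_zero_of_finsum hq
      simpa [hS] using right_ne_zero_of_mul hp
    _ = ∑ᶠ p : RightCosets H, ∑ q ∈ S, f (γ * p.out⁻¹) * g (p.out * q.out⁻¹) * k q.out :=
      (finsum_sum_comm S _ fun q _ => hfin q).symm
    _ = _ := finsum_congr fun p => (hq fun q => f (γ * p.out⁻¹) * g (p.out * q.out⁻¹)).symm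

/-- The characteristic function of the double coset `H g H`. -/
noncomputable def doubleCosetFun (H : Subgroup G) (g : G) : G → ℂ :=
  Set.indicator (DoubleCoset.doubleCoset g H H) 1

theorem doubleCosetFun_mem (g : G) : doubleCosetFun H g ∈ heckeSubmodule H := by
  refine ⟨fun h hh k hk x => ?_, {g}, Set.finite_singleton g, ?_⟩
  · have : h * x * k ∈ DoubleCoset.doubleCoset g H H ↔ x ∈ DoubleCoset.doubleCoset g H H := by
      simp only [DoubleCoset.mem_doubleCoset]
      constructor
      · rintro ⟨a, ha, b, hb, e⟩
        refine ⟨h⁻¹ * a, H.mul_mem (H.inv_mem hh) ha, b * k⁻¹, H.mul_mem hb (H.inv_mem hk), ?_⟩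
        have : x = h⁻¹ * (h * x * k) * k⁻¹ := by group
        rw [this, e]; group
      · rintro ⟨a, ha, b, hb, rfl⟩
        exact ⟨h * a, H.mul_mem hh ha, b * k, H.mul_mem hb hk, by group⟩
    simp only [doubleCosetFun]
    by_cases hx : x ∈ DoubleCoset.doubleCoset g H H
    · rw [Set.indicator_of_mem hx, Set.indicator_of_mem (this.2 hx)]; rfl
    · rw [Set.indicator_of_notMem hx, Set.indicator_of_notMem (mt this.1 hx)]
  · simp [doubleCosetFun]

theorem doubleCoset_one : DoubleCoset.doubleCoset (1 : G) H H = (H : Set G) := by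
  ext x
  rw [DoubleCoset.mem_doubleCoset]
  constructor
  · rintro ⟨a, ha, b, hb, rfl⟩
    simpa using H.mul_mem ha hb
  · intro hx
    exact ⟨x, hx, 1, H.one_mem, by simp⟩

theorem one_mem : Set.indicator (H : Set G) 1 ∈ heckeSubmodule H := by
  have := doubleCosetFun_mem (H := H) 1
  rwa [doubleCosetFun, doubleCoset_one] at this

theorem conv_one {f : G → ℂ} (hf : f ∈ heckeSubmodule H) :
    conv H f (Set.indicator (H : Set G) 1) = f := by
  funext γ
  rw [conv, finsum_eq_single _ (Quotient.mk (QuotientGroup.rightRel H) 1)]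
  · obtain ⟨h, hh, e⟩ := exists_out_eq (H := H) 1
    rw [e, mul_one, Set.indicator_of_mem (show h ∈ (H : Set G) from hh),
      right_inv_of_mem hf _ (H.inv_mem hh)]
    simp
  · intro q hq
    rw [Set.indicator_of_notMem, mul_zero]
    intro hm
    apply hq
    rw [← Quotient.out_eq q]
    refine Quotient.sound ?_
    change (QuotientGroup.rightRel H) q.out 1
    rw [QuotientGroup.rightRel_apply, one_mul]
    exact H.inv_mem hm

theorem one_conv {f : G → ℂ} (hf : f ∈ heckeSubmodule H) :
    conv H (Set.indicator (H : Set G) 1) f = f := by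
  funext γ
  rw [conv, finsum_eq_single _ (Quotient.mk (QuotientGroup.rightRel H) γ)]
  · obtain ⟨h, hh, e⟩ := exists_out_eq (H := H) γ
    have e2 : γ * (h * γ)⁻¹ = h⁻¹ := by group
    rw [e, e2, Set.indicator_of_mem (show h⁻¹ ∈ (H : Set G) from H.inv_mem hh),
      left_inv_of_mem hf _ hh]
    simp
  · intro q hq
    rw [Set.indicator_of_notMem, zero_mul]
    intro hm
    apply hq
    rw [← Quotient.out_eq q]
    refine Quotient.sound ?_
    change (QuotientGroup.rightRel H) q.out γ
    rw [QuotientGroup.rightRel_apply]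
    exact hm

/-- The involution `f*(γ) = conj (f (γ⁻¹))` on functions. -/
noncomputable def involution (f : G → ℂ) (γ : G) : ℂ := star (f γ⁻¹)

theorem involution_mem {f : G → ℂ} (hf : f ∈ heckeSubmodule H) :
    involution f ∈ heckeSubmodule H := by
  obtain ⟨hf, s, hs, hfs⟩ := hf
  refine ⟨fun h hh k hk x => ?_, (·⁻¹) '' s, hs.image _, fun x hx => ?_⟩
  · have : (h * x * k)⁻¹ = k⁻¹ * x⁻¹ * h⁻¹ := by group
    rw [involution, involution, this, hf _ (H.inv_mem hk) _ (H.inv_mem hh)]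
  · have hx' : f x⁻¹ ≠ 0 := fun h0 => hx (by simp [involution, h0])
    obtain ⟨g, hg, hxg⟩ := Set.mem_iUnion₂.1 (hfs hx')
    obtain ⟨a, ha, b, hb, e⟩ := DoubleCoset.mem_doubleCoset.1 hxg
    refine Set.mem_iUnion₂.2 ⟨g⁻¹, ⟨g, hg, rfl⟩, DoubleCoset.mem_doubleCoset.2
      ⟨b⁻¹, H.inv_mem hb, a⁻¹, H.inv_mem ha, ?_⟩⟩
    rw [← inv_inv x, e]; group

theorem involution_conv [IsHeckePair H] {f g : G → ℂ} (hf : f ∈ heckeSubmodule H)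
    (hg : g ∈ heckeSubmodule H) :
    involution (conv H f g) = conv H (involution g) (involution f) := by
  funext γ
  have h1 : involution (conv H f g) γ =
      ∑ᶠ q : RightCosets H, star (f (γ⁻¹ * q.out⁻¹)) * star (g q.out) := by
    have hfin : (Function.support fun q : RightCosets H =>
        f (γ⁻¹ * q.out⁻¹) * g q.out).Finite :=
      (finite_support_out hg).subset fun q hq => right_ne_zero_of_mul hq
    rw [involution, conv]
    refine ((starAddEquiv (R := ℂ)).toAddMonoidHom.map_finsum hfin).trans ?_
    exact finsum_congr fun q => by simp [mul_comm]
  rw [h1, conv, ← finsum_translate (F := fun x => involution g (γ * x⁻¹) * involution f x) ?_ γ]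
  · refine finsum_congr fun q => ?_
    have e1 : (γ * (q.out * γ)⁻¹)⁻¹ = q.out := by group
    have e2 : (q.out * γ)⁻¹ = γ⁻¹ * q.out⁻¹ := by group
    simp only [involution, e1]
    rw [e2, mul_comm]
  · intro h hh x
    have : γ * (h * x)⁻¹ = γ * x⁻¹ * h⁻¹ := by group
    simp only [this]
    rw [right_inv_of_mem (involution_mem hg) _ (H.inv_mem hh),
      left_inv_of_mem (involution_mem hf) _ hh]

theorem conv_add [IsHeckePair H] {f g k : G → ℂ} (hg : g ∈ heckeSubmodule H)
    (hk : k ∈ heckeSubmodule H) : conv H f (g + k) = conv H f g + conv H f k := by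
  funext γ
  have h : ∀ {g : G → ℂ}, g ∈ heckeSubmodule H → (Function.support fun q : RightCosets H =>
        f (γ * q.out⁻¹) * g q.out).Finite := fun hg =>
    (finite_support_out hg).subset fun q hq => right_ne_zero_of_mul hq
  rw [Pi.add_apply, conv, conv, conv, ← finsum_add_distrib (h hg) (h hk)]
  exact finsum_congr fun q => by simp [mul_add]

theorem add_conv [IsHeckePair H] {f g k : G → ℂ} (hk : k ∈ heckeSubmodule H) :
    conv H (f + g) k = conv H f k + conv H g k := by
  funext γ
  have h : ∀ f : G → ℂ, (Function.support fun q : RightCosets H =>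
        f (γ * q.out⁻¹) * k q.out).Finite := fun _ =>
    (finite_support_out hk).subset fun q hq => right_ne_zero_of_mul hq
  rw [Pi.add_apply, conv, conv, conv, ← finsum_add_distrib (h f) (h g)]
  exact finsum_congr fun q => by simp [add_mul]

theorem smul_conv (c : ℂ) (f g : G → ℂ) : conv H (c • f) g = c • conv H f g := by
  funext γ
  rw [Pi.smul_apply, smul_eq_mul, conv, conv, mul_finsum]
  exact finsum_congr fun q => by simp [mul_assoc]

theorem conv_smul (c : ℂ) (f g : G → ℂ) : conv H f (c • g) = c • conv H f g := by
  funext γ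
  rw [Pi.smul_apply, smul_eq_mul, conv, conv, mul_finsum]
  exact finsum_congr fun q => by simp [mul_left_comm]

end Aux

section Structure

variable {G : Type u} [Group G] {H : Subgroup G}

noncomputable instance : AddCommGroup (HeckeAlgebra H) :=
  inferInstanceAs (AddCommGroup (heckeSubmodule H))

noncomputable instance : Module ℂ (HeckeAlgebra H) :=
  inferInstanceAs (Module ℂ (heckeSubmodule H))

noncomputable instance [IsHeckePair H] : Ring (HeckeAlgebra H) where
  mul f g := ⟨conv H f.1 g.1, conv_mem f.2 g.2⟩
  one := ⟨Set.indicator (H : Set G) 1, one_mem⟩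
  mul_assoc f g k := Subtype.ext (conv_assoc f.2 g.2 k.2)
  one_mul f := Subtype.ext (one_conv f.2)
  mul_one f := Subtype.ext (conv_one f.2)
  left_distrib _ g k := Subtype.ext (conv_add g.2 k.2)
  right_distrib _ _ k := Subtype.ext (add_conv k.2)
  zero_mul g := Subtype.ext (funext fun _ => by
    change ∑ᶠ q : RightCosets H, (0 : ℂ) * g.1 q.out = 0
    simp)
  mul_zero f := Subtype.ext (funext fun γ => by
    change ∑ᶠ q : RightCosets H, f.1 (γ * q.out⁻¹) * (0 : ℂ) = 0
    simp)
  neg_add_cancel := neg_add_cancel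
  zsmul := fun n f => n • f
  zsmul_zero' := SubNegMonoid.zsmul_zero'
  zsmul_succ' := SubNegMonoid.zsmul_succ'
  zsmul_neg' := SubNegMonoid.zsmul_neg'
  nsmul := fun n f => n • f
  nsmul_zero := AddMonoid.nsmul_zero
  nsmul_succ := AddMonoid.nsmul_succ
  sub_eq_add_neg := sub_eq_add_neg

noncomputable instance [IsHeckePair H] : Algebra ℂ (HeckeAlgebra H) :=
  Algebra.ofModule (fun c f g => Subtype.ext (smul_conv c f.1 g.1))
    (fun c f g => Subtype.ext (conv_smul c f.1 g.1))

noncomputable instance [IsHeckePair H] : StarRing (HeckeAlgebra H) where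
  star f := ⟨involution f.1, involution_mem f.2⟩
  star_involutive f := Subtype.ext (funext fun γ => by simp [involution])
  star_mul f g := Subtype.ext (involution_conv f.2 g.2)
  star_add f g := Subtype.ext (funext fun γ =>
    star_add (f.1 γ⁻¹) (g.1 γ⁻¹))

instance [IsHeckePair H] : StarModule ℂ (HeckeAlgebra H) where
  star_smul c f := Subtype.ext (funext fun γ => by
    change star (c * f.1 γ⁻¹) = star c * star (f.1 γ⁻¹)
    rw [star_mul'])

/-- The characteristic function `[H g H]` as an element of the Hecke algebra. -/
noncomputable def doubleCosetElem (H : Subgroup G) (g : G) : HeckeAlgebra H :=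
  ⟨doubleCosetFun H g, doubleCosetFun_mem g⟩

end Structure

end HeckePair

/-! ### The `ax+b` groups -/

universe v w

/-- The group of matrices `!![1, y; 0, x]` with `y ∈ R` and `x ∈ Rˣ`. -/
@[ext]
structure AxB (R : Type v) [CommRing R] : Type v where
  y : R
  x : Rˣ

namespace AxB

section

variable {R S : Type v} [CommRing R] [CommRing S]

instance : Mul (AxB R) := ⟨fun p q => ⟨q.y + p.y * q.x, p.x * q.x⟩⟩
instance : One (AxB R) := ⟨⟨0, 1⟩⟩
instance : Inv (AxB R) := ⟨fun p => ⟨-(p.y * ↑p.x⁻¹), p.x⁻¹⟩⟩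

theorem mul_y (p q : AxB R) : (p * q).y = q.y + p.y * q.x := rfl
theorem mul_x (p q : AxB R) : (p * q).x = p.x * q.x := rfl
theorem one_y : (1 : AxB R).y = 0 := rfl
theorem one_x : (1 : AxB R).x = 1 := rfl
theorem inv_y (p : AxB R) : p⁻¹.y = -(p.y * ↑p.x⁻¹) := rfl
theorem inv_x (p : AxB R) : p⁻¹.x = p.x⁻¹ := rfl

instance : Group (AxB R) :=
  Group.ofLeftAxioms
    (fun p q r => by
      ext
      · simp only [mul_y, mul_x, Units.val_mul]; ring
      · simp only [mul_x, mul_assoc])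
    (fun p => by ext <;> simp [mul_y, mul_x, one_y, one_x])
    (fun p => by ext <;> simp [mul_y, mul_x, one_y, one_x, inv_y, inv_x])

/-- The matrix of an element. -/
def toMatrix (p : AxB R) : Matrix (Fin 2) (Fin 2) R := !![1, p.y; 0, (p.x : R)]

theorem toMatrix_mul (p q : AxB R) : (p * q).toMatrix = p.toMatrix * q.toMatrix := by
  simp [toMatrix, mul_y, mul_x]

/-- The homomorphism of `ax+b` groups induced by a ring homomorphism. -/
def map (f : R →+* S) : AxB R →* AxB S where
  toFun p := ⟨f p.y, Units.map (f : R →* S) p.x⟩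
  map_one' := by ext <;> simp [one_y, one_x]
  map_mul' p q := by ext <;> simp [mul_y, mul_x]

theorem map_y (f : R →+* S) (p : AxB R) : (map f p).y = f p.y := rfl
theorem map_x (f : R →+* S) (p : AxB R) : (map f p).x = Units.map (f : R →* S) p.x := rfl

instance [Finite R] : Finite (AxB R) :=
  Finite.of_injective (fun p : AxB R => (p.y, p.x)) fun p q h => by
    simp only [Prod.mk.injEq] at h
    exact AxB.ext h.1 h.2

end

end AxB

/-! ### The Hecke pair of a number field -/

namespace NFHecke

open HeckePair

variable (K : Type v) [Field K] [NumberField K]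

/-- The group `P_K`, all matrices `!![1, y; 0, x]` with `y ∈ K`, `x ∈ Kˣ`. -/
abbrev PK : Type v := AxB K

/-- The subgroup `P_𝓞` of `P_K`, the matrices with `y ∈ 𝓞` and `x ∈ 𝓞ˣ`. -/
def PO : Subgroup (PK K) := (AxB.map (algebraMap (𝓞 K) K)).range

/-- The quotient `K / 𝓞`, an `𝓞`-module. -/
abbrev KModO : Type v := K ⧸ LinearMap.range (Algebra.linearMap (𝓞 K) K)

/-- The class of `x ∈ K` in `K / 𝓞`. -/
def cls (x : K) : KModO K := Submodule.Quotient.mk x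

variable {K}

theorem finite_quotient_span {d : 𝓞 K} (hd : d ≠ 0) : Finite (𝓞 K ⧸ Ideal.span {d}) :=
  Ideal.finiteQuotientOfFreeOfNeBot _ (by simpa using hd)

theorem exists_denominator (z w : K) :
    ∃ d : 𝓞 K, d ≠ 0 ∧ (∃ a : 𝓞 K, algebraMap (𝓞 K) K a = algebraMap (𝓞 K) K d * z) ∧
      ∃ b : 𝓞 K, algebraMap (𝓞 K) K b = algebraMap (𝓞 K) K d * w := by
  obtain ⟨a, b, hb, rfl⟩ := IsFractionRing.div_surjective (A := 𝓞 K) z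
  obtain ⟨c, e, he, rfl⟩ := IsFractionRing.div_surjective (A := 𝓞 K) w
  have hb0 : algebraMap (𝓞 K) K b ≠ 0 := by simpa using nonZeroDivisors.ne_zero hb
  have he0 : algebraMap (𝓞 K) K e ≠ 0 := by simpa using nonZeroDivisors.ne_zero he
  refine ⟨b * e, mul_ne_zero (nonZeroDivisors.ne_zero hb) (nonZeroDivisors.ne_zero he),
    ⟨a * e, ?_⟩, ⟨c * b, ?_⟩⟩
  · simp only [map_mul]
    field_simp
  · simp only [map_mul]
    field_simp

/-- `(P_K, P_𝓞)` is a Hecke pair. -/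
instance : IsHeckePair (PO K) where
  finite_rightCosetsIn γ := by
    obtain ⟨d, hd, ⟨a, ha⟩, ⟨b, hb⟩⟩ := exists_denominator ((γ.x : K)⁻¹) (γ.y * (γ.x : K)⁻¹)
    have hx : (γ.x : K) ≠ 0 := γ.x.ne_zero
    have := finite_quotient_span hd
    let π : AxB (𝓞 K) →* AxB (𝓞 K ⧸ Ideal.span {d}) := AxB.map (Ideal.Quotient.mk _)
    let ι : AxB (𝓞 K) →* PK K := AxB.map (algebraMap (𝓞 K) K)
    let F : AxB (𝓞 K) → RightCosets (PO K) := fun h => Quotient.mk _ (γ * ι h)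
    have key : ∀ k : AxB (𝓞 K), π k = 1 → γ * ι k * γ⁻¹ ∈ PO K := by
      intro k hk
      have h1 : Ideal.Quotient.mk (Ideal.span {d}) k.y = 0 := congrArg AxB.y hk
      have h2 : Ideal.Quotient.mk (Ideal.span {d}) (k.x : 𝓞 K) = 1 :=
        congrArg (fun p : AxB (𝓞 K ⧸ Ideal.span {d}) => (p.x : 𝓞 K ⧸ Ideal.span {d})) hk
      rw [Ideal.Quotient.eq_zero_iff_mem, Ideal.mem_span_singleton] at h1
      rw [← map_one (Ideal.Quotient.mk (Ideal.span {d})), Ideal.Quotient.mk_eq_mk_iff_sub_mem,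
        Ideal.mem_span_singleton] at h2
      obtain ⟨s, hs⟩ := h1
      obtain ⟨t, ht⟩ := h2
      have hs' : algebraMap (𝓞 K) K k.y = algebraMap (𝓞 K) K d * algebraMap (𝓞 K) K s := by rw [hs, map_mul]
      have ht' : algebraMap (𝓞 K) K k.x = 1 + algebraMap (𝓞 K) K d * algebraMap (𝓞 K) K t := by
        rw [← map_mul, ← ht]; simp
      refine ⟨⟨s * a + b * t, k.x⟩, ?_⟩
      ext
      · simp only [AxB.map_y, AxB.mul_y, AxB.inv_y, AxB.inv_x, map_add, map_mul, ι, ha, hb,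
          AxB.map_x, Units.coe_map, MonoidHom.coe_coe, hs', ht', Units.val_inv_eq_inv_val]
        field_simp
        ring
      · simp only [AxB.map_x, AxB.mul_x, AxB.inv_x, ι]
        simp [mul_comm]
    have hF : ∀ h h', π h = π h' → F h = F h' := by
      intro h h' e
      refine Quotient.sound ?_
      change (QuotientGroup.rightRel (PO K)) _ _
      rw [QuotientGroup.rightRel_apply]
      have := key (h' * h⁻¹) (by rw [map_mul, map_inv, e, mul_inv_cancel])
      rw [map_mul, map_inv] at this
      convert this using 1
      group
    have hfac : Function.FactorsThrough F π := fun h h' e => hF h h' e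
    refine (Set.finite_range (fun p => Function.extend π F (fun _ => F 1) p)).subset ?_
    rintro _ ⟨g, hg, rfl⟩
    obtain ⟨p, hp, q, ⟨h, rfl⟩, rfl⟩ := DoubleCoset.mem_doubleCoset.1 hg
    refine ⟨π h, ?_⟩
    change Function.extend π F (fun _ => F 1) (π h) = _
    rw [hfac.extend_apply]
    refine Quotient.sound ?_
    change (QuotientGroup.rightRel (PO K)) _ _
    rw [QuotientGroup.rightRel_apply]
    convert (show p ∈ PO K from hp) using 1
    change p * γ * ι h * (γ * ι h)⁻¹ = p
    group

noncomputable instance fintypeQuotientSpan (a : (𝓞 K)⁰) :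
    Fintype (𝓞 K ⧸ Ideal.span {(a : 𝓞 K)}) :=
  haveI := finite_quotient_span (nonZeroDivisors.coe_ne_zero a)
  Fintype.ofFinite _

/-- The index of the stabilizer `𝓞ˣ_r` in `𝓞ˣ` is finite. -/
noncomputable instance fintypeUnitsQuotient (r : KModO K) :
    Fintype ((𝓞 K)ˣ ⧸ MulAction.stabilizer (𝓞 K)ˣ r) :=
  haveI : Finite ((𝓞 K)ˣ ⧸ MulAction.stabilizer (𝓞 K)ˣ r) := by
    obtain ⟨z, rfl⟩ := Submodule.Quotient.mk_surjective _ r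
    obtain ⟨d, hd, ⟨a, ha⟩, -⟩ := exists_denominator z 0
    have := finite_quotient_span hd
    let π : (𝓞 K)ˣ →* (𝓞 K ⧸ Ideal.span {d})ˣ :=
      Units.map (Ideal.Quotient.mk (Ideal.span {d}) : 𝓞 K →* 𝓞 K ⧸ Ideal.span {d})
    have hle : π.ker ≤ MulAction.stabilizer (𝓞 K)ˣ
        (Submodule.Quotient.mk z : KModO K) := by
      intro u hu
      rw [MonoidHom.mem_ker] at hu
      have h2 : Ideal.Quotient.mk (Ideal.span {d}) (u : 𝓞 K) = 1 := congrArg Units.val hu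
      rw [← map_one (Ideal.Quotient.mk (Ideal.span {d})), Ideal.Quotient.mk_eq_mk_iff_sub_mem,
        Ideal.mem_span_singleton] at h2
      obtain ⟨t, ht⟩ := h2
      rw [MulAction.mem_stabilizer_iff, Units.smul_def, ← Submodule.Quotient.mk_smul,
        Submodule.Quotient.eq]
      refine ⟨t * a, ?_⟩
      have ht' : algebraMap (𝓞 K) K u = 1 + algebraMap (𝓞 K) K d * algebraMap (𝓞 K) K t := by
        rw [← map_mul, ← ht]; simp
      rw [Algebra.linearMap_apply, map_mul, ha, Algebra.smul_def, ht']
      ring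
    have : π.ker.FiniteIndex := inferInstance
    have := Subgroup.finiteIndex_of_le hle
    exact Subgroup.finite_quotient_of_finiteIndex
  Fintype.ofFinite _

/-- The matrix `!![1, x; 0, 1]`. -/
def unip (x : K) : PK K := ⟨x, 1⟩

theorem doubleCoset_unip {x y : K} (h : cls K x = cls K y) :
    DoubleCoset.doubleCoset (unip x) (PO K) (PO K) =
      DoubleCoset.doubleCoset (unip y) (PO K) (PO K) := by
  refine DoubleCoset.doubleCoset_eq_of_mem (DoubleCoset.mem_doubleCoset.2 ?_)
  obtain ⟨c, hc⟩ := (Submodule.Quotient.eq _).1 h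
  refine ⟨AxB.map (algebraMap (𝓞 K) K) ⟨c, 1⟩, ⟨_, rfl⟩, 1, (PO K).one_mem, ?_⟩
  rw [Algebra.linearMap_apply] at hc
  ext
  · simp [AxB.mul_y, AxB.map_y, unip, hc]
  · simp [AxB.mul_x, AxB.map_x, unip]

/-- `R(r)` for `r ∈ K / 𝓞`: the number of right cosets in the double coset of `!![1, r; 0, 1]`. -/
noncomputable def numR (r : KModO K) : ℕ :=
  Quotient.liftOn' r (fun x => numRightCosets (PO K) (unip x)) fun x y h => by
    have h' : cls K x = cls K y := Quotient.sound' h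
    simp only [numRightCosets, rightCosetsIn, doubleCoset_unip h']

/-- `θ_r = R(r)⁻¹ [P_𝓞 !![1, r; 0, 1] P_𝓞]` for `r ∈ K / 𝓞`. -/
noncomputable def theta (r : KModO K) : HeckeAlgebra (PO K) :=
  Quotient.liftOn' r
    (fun x => (1 / (numRightCosets (PO K) (unip x) : ℂ)) • doubleCosetElem (PO K) (unip x))
    fun x y h => by
      have h' : cls K x = cls K y := Quotient.sound' h
      simp only [numRightCosets, rightCosetsIn, doubleCosetElem, doubleCosetFun,
        doubleCoset_unip h']

/-- The absolute norm `N_a = |𝓞 / a𝓞|`. -/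
noncomputable def normN (a : (𝓞 K)⁰) : ℕ := Nat.card (𝓞 K ⧸ Ideal.span {(a : 𝓞 K)})

/-- The matrix `!![1, 0; 0, a]` for a nonzero integer `a`. -/
noncomputable def diag (a : (𝓞 K)⁰) : PK K :=
  ⟨0, Units.mk0 (algebraMap (𝓞 K) K a) (by simp)⟩

/-- `μ_a = N_a^(-1/2) [P_𝓞 !![1, 0; 0, a] P_𝓞]` for a nonzero integer `a`. -/
noncomputable def mu (a : (𝓞 K)⁰) : HeckeAlgebra (PO K) :=
  ((1 / Real.sqrt (normN a) : ℝ) : ℂ) • doubleCosetElem (PO K) (diag a)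

/-- The class of `(x + b) / a` in `K / 𝓞`, for `b ∈ 𝓞 / a𝓞`. -/
noncomputable def divClass (a : (𝓞 K)⁰) (x : K) (b : 𝓞 K ⧸ Ideal.span {(a : 𝓞 K)}) : KModO K :=
  Quotient.liftOn' b (fun c : 𝓞 K => cls K ((x + algebraMap (𝓞 K) K c) / algebraMap (𝓞 K) K a)) fun c c' h => by
    rw [Submodule.quotientRel_def] at h
    obtain ⟨e, he⟩ := Ideal.mem_span_singleton.1 h
    refine (Submodule.Quotient.eq _).2 ⟨e, ?_⟩
    have ha : algebraMap (𝓞 K) K a ≠ 0 := by simp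
    have he' : algebraMap (𝓞 K) K c - algebraMap (𝓞 K) K c' =
        algebraMap (𝓞 K) K a * algebraMap (𝓞 K) K e := by
      rw [← map_mul, ← he, map_sub]
    rw [Algebra.linearMap_apply, ← sub_div, add_sub_add_left_eq_sub, he',
      mul_div_cancel_left₀ _ ha]


/-- The defining relations, for families `m : 𝓞 \ {0} → A` and `t : K / 𝓞 → A` of elements of a
unital complex *-algebra `A`. -/
structure Relations {A : Type w} [Ring A] [StarRing A] [Algebra ℂ A]
    (m : (𝓞 K)⁰ → A) (t : KModO K → A) : Prop where
  /-- units act trivially -/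
  mu_unit : ∀ a : (𝓞 K)⁰, IsUnit (a : 𝓞 K) → m a = 1
  /-- each `m a` is an isometry -/
  star_mu_mul_mu : ∀ a, star (m a) * m a = 1
  /-- `m` is multiplicative -/
  mu_mul : ∀ a b, m a * m b = m (a * b)
  /-- `t` is normalized -/
  theta_zero : t 0 = 1
  /-- `t` is constant on `𝓞ˣ`-orbits -/
  theta_smul : ∀ (r : KModO K) (w : (𝓞 K)ˣ), t (w • r) = t r
  /-- each `t r` is self-adjoint -/
  star_theta : ∀ r, star (t r) = t r
  /-- the product formula; `MulAction.ofQuotientStabilizer _ r u` is `u r` for `u ∈ 𝓞ˣ / 𝓞ˣ_r`. -/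
  theta_mul : ∀ r s : KModO K, t r * t s =
    ((1 / (numR r : ℂ)) * (1 / (numR s : ℂ))) •
      ∑ u : (𝓞 K)ˣ ⧸ MulAction.stabilizer (𝓞 K)ˣ r,
        ∑ v : (𝓞 K)ˣ ⧸ MulAction.stabilizer (𝓞 K)ˣ s,
          t (MulAction.ofQuotientStabilizer (𝓞 K)ˣ r u +
            MulAction.ofQuotientStabilizer (𝓞 K)ˣ s v)
  /-- the covariance relation, for the class of an arbitrary `x ∈ K` -/
  mu_theta_star_mu : ∀ (a : (𝓞 K)⁰) (x : K), m a * t (cls K x) * star (m a) =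
    (1 / (normN a : ℂ)) • ∑ b : 𝓞 K ⧸ Ideal.span {(a : 𝓞 K)}, t (divClass a x b)

/-- The set of monomials `μ_a^* θ_r μ_b`. -/
def monomials (K : Type v) [Field K] [NumberField K] : Set (HeckeAlgebra (PO K)) :=
  {f | ∃ (a b : (𝓞 K)⁰) (r : KModO K), f = star (mu a) * theta r * mu b}

end NFHecke

set_option linter.unusedSectionVars false

/-! Write H for the subgroup. A bi-invariant function is a finite combination of characteristic
functions of right cosets, say f = ∑ c_i [H a_i]. Averaging over the right cosets inside each double
coset replaces every [H a_i] by [H a_i H]/R(a_i), which is `normElem`: f = ∑ c_i `normElem` a_i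
(`eq_sum_normElem`). Convolution multiplies coset representatives, so products become sums of
`normElem` of products (`mul_eq_sum_normElem`, `mul_normElem`). With explicit transversals for the
double cosets of `unip x`, `diag a` and `(diag a)⁻¹`, the relations reduce to identities between 2×2
matrices.

The same calculus shows that μ_a^* θ_x μ_b is a nonzero multiple of `normElem` of the matrix with
entries y = x b and b/a (`monomial_eq`). Every element of P_K has this shape, and the multiple
depends only on the double coset. Since distinct double cosets are disjoint, the monomials form a
basis.

For universality, a linear map is prescribed on this basis. It is well defined if equal monomials in
the Hecke algebra have equal counterparts in every solution of the relations (`monomial_congr`). The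
key is the commutation rule t_x m_a = m_a t_{ax} (`theta_mul_mu`): m_a m_a^* is the average of t
over the unit-invariant set a⁻¹𝓞/𝓞, and multiplying such an average by t_x translates it by x,
because the orbit averages in the product formula are absorbed.

Multiplicativity needs no structure constants. In any solution the span of the monomials is closed
under multiplication (`mul_mem_span_monomials`). Applied to the pairs (μ_a, m_a), (θ_r, t_r) in the
product algebra, this says that the graph of the linear map is closed under multiplication. -/

namespace HeckePair

universe u

/-! ### Expansions in right cosets and normalized double cosets. -/

section RightCosetExpansion

variable {G : Type u} [Group G] {H : Subgroup G}

/-- The inclusion of the Hecke algebra in the space of all functions. -/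
def toFunₗ (H : Subgroup G) : HeckeAlgebra H →ₗ[ℂ] (G → ℂ) := (heckeSubmodule H).subtype

theorem toFunₗ_injective : Function.Injective (toFunₗ H) := Subtype.val_injective

theorem toFunₗ_mem (f : HeckeAlgebra H) : toFunₗ H f ∈ heckeSubmodule H := f.2

theorem toFunₗ_mul [IsHeckePair H] (f g : HeckeAlgebra H) :
    toFunₗ H (f * g) = conv H (toFunₗ H f) (toFunₗ H g) := rfl

theorem toFunₗ_doubleCosetElem (g : G) :
    toFunₗ H (doubleCosetElem H g) = doubleCosetFun H g := rfl

/-- The characteristic function of the right coset `H g`. -/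
noncomputable def rightCosetFun (H : Subgroup G) (g : G) : G → ℂ :=
  Set.indicator {γ | γ * g⁻¹ ∈ H} 1

/-- The characteristic function of `H g H`, divided by the number of right cosets in `H g H`. -/
noncomputable def normElem (H : Subgroup G) (g : G) : HeckeAlgebra H :=
  (1 / (numRightCosets H g : ℂ)) • doubleCosetElem H g

theorem mk_eq_mk_iff {a b : G} :
    Quotient.mk (QuotientGroup.rightRel H) a = Quotient.mk (QuotientGroup.rightRel H) b ↔
      b * a⁻¹ ∈ H := by
  rw [Quotient.eq]
  exact QuotientGroup.rightRel_apply

theorem mk_eq_mk_iff' {a b : G} :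
    Quotient.mk (QuotientGroup.rightRel H) a = Quotient.mk (QuotientGroup.rightRel H) b ↔
      a * b⁻¹ ∈ H := by
  rw [eq_comm, mk_eq_mk_iff]

open Classical in
theorem rightCosetFun_apply (g γ : G) : rightCosetFun H g γ =
    if Quotient.mk (QuotientGroup.rightRel H) γ = Quotient.mk (QuotientGroup.rightRel H) g
      then 1 else 0 := by
  rw [rightCosetFun, Set.indicator_apply]
  simp [mk_eq_mk_iff']

theorem rightCosetFun_congr {a b : G} (h : a * b⁻¹ ∈ H) :
    rightCosetFun H a = rightCosetFun H b := by
  funext γ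
  rw [rightCosetFun_apply, rightCosetFun_apply, mk_eq_mk_iff'.2 h]

theorem rightCosetFun_mul_inv (a b γ : G) :
    rightCosetFun H a (γ * b⁻¹) = rightCosetFun H (a * b) γ := by
  classical
  simp only [rightCosetFun_apply, mk_eq_mk_iff', mul_inv_rev, mul_assoc]

theorem mk_mem_rightCosetsIn {g γ : G} :
    Quotient.mk (QuotientGroup.rightRel H) γ ∈ rightCosetsIn H g ↔
      γ ∈ DoubleCoset.doubleCoset g H H := by
  constructor
  · rintro ⟨x, hx, e⟩
    rw [mk_eq_mk_iff] at e
    obtain ⟨a, ha, b, hb, rfl⟩ := DoubleCoset.mem_doubleCoset.1 hx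
    refine DoubleCoset.mem_doubleCoset.2 ⟨γ * (a * g * b)⁻¹ * a, H.mul_mem e ha, b, hb, ?_⟩
    group
  · exact fun h => ⟨γ, h, rfl⟩

theorem mem_doubleCoset_self (g : G) : g ∈ DoubleCoset.doubleCoset g H H :=
  DoubleCoset.mem_doubleCoset.2 ⟨1, H.one_mem, 1, H.one_mem, by simp⟩

theorem normElem_congr {a b : G}
    (h : DoubleCoset.doubleCoset a H H = DoubleCoset.doubleCoset b H H) :
    normElem H a = normElem H b := by
  simp only [normElem, numRightCosets, rightCosetsIn, doubleCosetElem, doubleCosetFun, h]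

theorem normElem_mul_mul {h k : G} (hh : h ∈ H) (g : G) (hk : k ∈ H) :
    normElem H (h * g * k) = normElem H g :=
  normElem_congr (DoubleCoset.doubleCoset_eq_of_mem
    (DoubleCoset.mem_doubleCoset.2 ⟨h, hh, k, hk, rfl⟩))

theorem normElem_mul_right (g : G) {k : G} (hk : k ∈ H) : normElem H (g * k) = normElem H g := by
  simpa using normElem_mul_mul H.one_mem g hk

/-- Counting right cosets and expanding the characteristic function of a double coset, by means
of a transversal. -/
theorem doubleCoset_transversal {ι : Type*} [Fintype ι] {g : G} (a : ι → G)
    (hinj : ∀ i j, a i * (a j)⁻¹ ∈ H → i = j) (hmem : ∀ i, a i ∈ DoubleCoset.doubleCoset g H H)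
    (hcov : ∀ k ∈ H, ∃ i, g * k * (a i)⁻¹ ∈ H) :
    numRightCosets H g = Fintype.card ι ∧
      doubleCosetFun H g = ∑ i, rightCosetFun H (a i) := by
  classical
  have hcov' : ∀ γ ∈ DoubleCoset.doubleCoset g H H, ∃ i,
      Quotient.mk (QuotientGroup.rightRel H) γ = Quotient.mk _ (a i) := by
    intro γ hγ
    obtain ⟨h, hh, k, hk, rfl⟩ := DoubleCoset.mem_doubleCoset.1 hγ
    obtain ⟨i, hi⟩ := hcov k hk
    refine ⟨i, mk_eq_mk_iff'.2 ?_⟩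
    simpa only [mul_assoc] using H.mul_mem hh hi
  constructor
  · have hr : rightCosetsIn H g =
        Set.range fun i => Quotient.mk (QuotientGroup.rightRel H) (a i) := by
      ext q
      constructor
      · rintro ⟨γ, hγ, rfl⟩
        obtain ⟨i, hi⟩ := hcov' γ hγ
        exact ⟨i, hi.symm⟩
      · rintro ⟨i, rfl⟩
        exact ⟨a i, hmem i, rfl⟩
    rw [numRightCosets, hr, ← Set.image_univ, Set.ncard_image_of_injective, Set.ncard_univ,
      Nat.card_eq_fintype_card]
    exact fun i j e => hinj i j (mk_eq_mk_iff'.1 e)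
  · funext γ
    rw [doubleCosetFun, Set.indicator_apply, Finset.sum_apply]
    simp only [rightCosetFun_apply]
    split_ifs with hγ
    · obtain ⟨i, hi⟩ := hcov' γ hγ
      rw [Finset.sum_eq_single i, if_pos hi, Pi.one_apply]
      · intro j _ hj
        rw [if_neg]
        intro e
        exact hj (hinj j i (mk_eq_mk_iff'.1 (e.symm.trans hi)))
      · simp
    · symm
      refine Finset.sum_eq_zero fun i _ => if_neg fun e => hγ ?_
      rw [← mk_mem_rightCosetsIn, e, mk_mem_rightCosetsIn]
      exact hmem i

section

variable [IsHeckePair H]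

theorem numRightCosets_ne_zero (g : G) : (numRightCosets H g : ℂ) ≠ 0 := by
  rw [Nat.cast_ne_zero, numRightCosets,
    ← Nat.pos_iff_ne_zero, Set.ncard_pos (IsHeckePair.finite_rightCosetsIn g)]
  exact ⟨_, mk_mem_rightCosetsIn.2 (mem_doubleCoset_self g)⟩

-- The weight is expressed through γ instead of g, which is harmless because the two double cosets
-- agree wherever the value is nonzero. In this form it factors out of a sum over several g.
open Classical in
theorem toFunₗ_normElem_apply (g γ : G) : toFunₗ H (normElem H g) γ =
    (1 / (numRightCosets H γ : ℂ)) * if g ∈ DoubleCoset.doubleCoset γ H H then 1 else 0 := by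
  rw [normElem, map_smul, toFunₗ_doubleCosetElem, Pi.smul_apply, smul_eq_mul, doubleCosetFun,
    Set.indicator_apply]
  by_cases h : g ∈ DoubleCoset.doubleCoset γ H H
  · have e := DoubleCoset.doubleCoset_eq_of_mem h
    rw [if_pos h, e, if_pos (mem_doubleCoset_self γ)]
    simp only [numRightCosets, rightCosetsIn, e, Pi.one_apply]
  · rw [if_neg h, if_neg]
    · simp
    · intro h'
      rw [DoubleCoset.doubleCoset_eq_of_mem h'] at h
      exact h (mem_doubleCoset_self g)

/-- A bi-invariant combination of right cosets is the same combination of normalized double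
cosets. -/
theorem eq_sum_normElem {ι : Type*} (s : Finset ι) (c : ι → ℂ) (a : ι → G) {f : HeckeAlgebra H}
    (hf : toFunₗ H f = ∑ i ∈ s, c i • rightCosetFun H (a i)) :
    f = ∑ i ∈ s, c i • normElem H (a i) := by
  classical
  apply toFunₗ_injective
  funext γ
  set T := (IsHeckePair.finite_rightCosetsIn (H := H) γ).toFinset with hT
  -- The sum of f over the right cosets in HγH is computed twice: by bi-invariance, and by counting
  -- which H a_i lie in HγH.
  have h1 : ∑ q ∈ T, toFunₗ H f q.out = (numRightCosets H γ : ℂ) * toFunₗ H f γ := by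
    rw [numRightCosets, Set.ncard_eq_toFinset_card _ (IsHeckePair.finite_rightCosetsIn (H := H) γ),
      ← nsmul_eq_mul]
    refine Finset.sum_eq_card_nsmul fun q hq => ?_
    rw [hT, Set.Finite.mem_toFinset, ← Quotient.out_eq q, mk_mem_rightCosetsIn] at hq
    obtain ⟨h, hh, k, hk, e⟩ := DoubleCoset.mem_doubleCoset.1 hq
    rw [e]
    exact (toFunₗ_mem f).1 h hh k hk γ
  have h2 : ∑ q ∈ T, toFunₗ H f q.out =
      ∑ i ∈ s, c i * if a i ∈ DoubleCoset.doubleCoset γ H H then 1 else 0 := by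
    simp only [hf, Finset.sum_apply, Pi.smul_apply, smul_eq_mul]
    rw [Finset.sum_comm]
    refine Finset.sum_congr rfl fun i _ => ?_
    rw [← Finset.mul_sum]
    congr 1
    simp only [rightCosetFun_apply, Quotient.out_eq]
    rw [Finset.sum_ite_eq']
    simp only [hT, Set.Finite.mem_toFinset, mk_mem_rightCosetsIn]
  have h3 : toFunₗ H f γ = (1 / (numRightCosets H γ : ℂ)) * ∑ q ∈ T, toFunₗ H f q.out := by
    rw [h1, ← mul_assoc, one_div_mul_cancel (numRightCosets_ne_zero γ), one_mul]
  rw [h3, h2, map_sum, Finset.sum_apply, Finset.mul_sum]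
  refine Finset.sum_congr rfl fun i _ => ?_
  rw [map_smul, Pi.smul_apply, smul_eq_mul, toFunₗ_normElem_apply]
  ring

/-- Each H b_j contributes a single term, and right invariance of f makes that term independent of
the chosen representative. -/
theorem conv_sum_rightCosetFun {f : G → ℂ} (hf : f ∈ heckeSubmodule H) {κ : Type*}
    (t : Finset κ) (d : κ → ℂ) (b : κ → G) (γ : G) :
    conv H f (∑ j ∈ t, d j • rightCosetFun H (b j)) γ = ∑ j ∈ t, d j * f (γ * (b j)⁻¹) := by
  classical
  have key : ∀ j (q : RightCosets H), f (γ * q.out⁻¹) * (d j * rightCosetFun H (b j) q.out) =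
      if q = Quotient.mk _ (b j) then d j * f (γ * (b j)⁻¹) else 0 := by
    intro j q
    rw [rightCosetFun_apply, Quotient.out_eq]
    split_ifs with h
    · subst h
      obtain ⟨h, hh, e⟩ := exists_out_eq (H := H) (b j)
      rw [e, mul_inv_rev, ← mul_assoc γ, right_inv_of_mem hf _ (H.inv_mem hh)]
      ring
    · simp
  simp only [conv, Finset.sum_apply, Pi.smul_apply, smul_eq_mul, Finset.mul_sum, key]
  rw [finsum_sum_comm]
  · refine Finset.sum_congr rfl fun j _ => ?_
    rw [finsum_eq_single _ (Quotient.mk _ (b j)), if_pos rfl]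
    intro q hq
    rw [if_neg hq]
  · intro j _
    refine (Set.finite_singleton (Quotient.mk _ (b j))).subset fun q hq => ?_
    by_contra h
    exact hq (if_neg h)

/-- The convolution expands as ∑ c_i d_j [H a_i b_j]. The single summands need not be bi-invariant,
but the total is, so `eq_sum_normElem` applies. -/
theorem mul_eq_sum_normElem {ι κ : Type*} (s : Finset ι) (c : ι → ℂ) (a : ι → G)
    (t : Finset κ) (d : κ → ℂ) (b : κ → G) {f g : HeckeAlgebra H}
    (hf : toFunₗ H f = ∑ i ∈ s, c i • rightCosetFun H (a i))
    (hg : toFunₗ H g = ∑ j ∈ t, d j • rightCosetFun H (b j)) :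
    f * g = ∑ i ∈ s, ∑ j ∈ t, (c i * d j) • normElem H (a i * b j) := by
  rw [← Finset.sum_product']
  refine eq_sum_normElem (s ×ˢ t) (fun p => c p.1 * d p.2) (fun p => a p.1 * b p.2) ?_
  funext γ
  rw [toFunₗ_mul, hg, conv_sum_rightCosetFun (toFunₗ_mem f), hf]
  simp only [Finset.sum_apply, Pi.smul_apply, smul_eq_mul, rightCosetFun_mul_inv, Finset.mul_sum]
  rw [Finset.sum_product, Finset.sum_comm]
  exact Finset.sum_congr rfl fun i _ => Finset.sum_congr rfl fun j _ => by ring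

theorem doubleCosetFun_eq_sum (g : G) :
    doubleCosetFun H g = ∑ q ∈ (IsHeckePair.finite_rightCosetsIn (H := H) g).toFinset,
      rightCosetFun H q.out := by
  classical
  funext γ
  rw [Finset.sum_apply]
  simp only [rightCosetFun_apply, Quotient.out_eq]
  rw [Finset.sum_ite_eq, doubleCosetFun, Set.indicator_apply]
  simp [mk_mem_rightCosetsIn]

/-- No transversal for HgH is required: its right cosets can be written H g k with k in H, and
`normElem` ignores the factor k on the right, so all of them contribute equally. -/
theorem mul_normElem {ι : Type*} (s : Finset ι) (c : ι → ℂ) (a : ι → G) {f : HeckeAlgebra H}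
    (hf : toFunₗ H f = ∑ i ∈ s, c i • rightCosetFun H (a i)) (g : G) :
    f * normElem H g = ∑ i ∈ s, c i • normElem H (a i * g) := by
  set T := (IsHeckePair.finite_rightCosetsIn (H := H) g).toFinset with hT
  have hk : ∀ q : RightCosets H, ∃ k ∈ H, q ∈ T → q.out * (g * k)⁻¹ ∈ H := by
    intro q
    by_cases hq : q ∈ T
    · have hq' := hq
      rw [hT, Set.Finite.mem_toFinset, ← Quotient.out_eq q, mk_mem_rightCosetsIn] at hq'
      obtain ⟨h, hh, k, hk, e⟩ := DoubleCoset.mem_doubleCoset.1 hq'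
      refine ⟨k, hk, fun _ => ?_⟩
      have : h * g * k * (g * k)⁻¹ = h := by group
      rwa [e, this]
    -- Cosets outside HgH never enter the sum; 1 is a filler.
    · exact ⟨1, H.one_mem, fun h => absurd h hq⟩
  choose k hk hkq using hk
  have hg : toFunₗ H (normElem H g) =
      ∑ q ∈ T, (1 / (numRightCosets H g : ℂ)) • rightCosetFun H (g * k q) := by
    rw [normElem, map_smul, toFunₗ_doubleCosetElem, doubleCosetFun_eq_sum, Finset.smul_sum]
    exact Finset.sum_congr rfl fun q hq => by rw [rightCosetFun_congr (hkq q hq)]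
  rw [mul_eq_sum_normElem s c a T _ _ hf hg]
  refine Finset.sum_congr rfl fun i _ => ?_
  simp only [← mul_assoc, normElem_mul_right _ (hk _)]
  rw [Finset.sum_const, ← Nat.cast_smul_eq_nsmul ℂ, smul_smul, hT,
    ← Set.ncard_eq_toFinset_card _ (IsHeckePair.finite_rightCosetsIn (H := H) g)]
  congr 1
  change (numRightCosets H g : ℂ) * _ = _
  field_simp [numRightCosets_ne_zero g]

theorem normElem_one : normElem H (1 : G) = 1 := by
  have h := doubleCoset_transversal (H := H) (g := 1) (fun _ : Unit => (1 : G))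
    (fun _ _ _ => rfl) (fun _ => mem_doubleCoset_self 1) (fun k hk => ⟨(), by simpa using hk⟩)
  apply toFunₗ_injective
  rw [normElem, h.1, map_smul, toFunₗ_doubleCosetElem, doubleCosetFun, doubleCoset_one]
  simp
  rfl

theorem star_doubleCosetElem (g : G) :
    star (doubleCosetElem H g) = doubleCosetElem H g⁻¹ := by
  classical
  apply toFunₗ_injective
  funext γ
  change star (doubleCosetFun H g γ⁻¹) = doubleCosetFun H g⁻¹ γ
  have : γ⁻¹ ∈ DoubleCoset.doubleCoset g H H ↔ γ ∈ DoubleCoset.doubleCoset g⁻¹ H H := by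
    simp only [DoubleCoset.mem_doubleCoset]
    constructor
    · rintro ⟨a, ha, b, hb, e⟩
      exact ⟨b⁻¹, H.inv_mem hb, a⁻¹, H.inv_mem ha, by rw [← inv_inv γ, e]; group⟩
    · rintro ⟨a, ha, b, hb, rfl⟩
      exact ⟨b⁻¹, H.inv_mem hb, a⁻¹, H.inv_mem ha, by group⟩
  simp only [doubleCosetFun, Set.indicator_apply, this]
  split_ifs <;> simp

theorem span_normElem : Submodule.span ℂ (Set.range (normElem H)) = ⊤ := by
  rw [Submodule.eq_top_iff']
  intro f
  have hf : toFunₗ H f = ∑ q ∈ (finite_support_out (toFunₗ_mem f)).toFinset,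
      toFunₗ H f q.out • rightCosetFun H q.out := by
    classical
    funext γ
    simp only [Finset.sum_apply, Pi.smul_apply, smul_eq_mul, rightCosetFun_apply,
      Quotient.out_eq, mul_ite, mul_one, mul_zero]
    rw [Finset.sum_ite_eq, apply_out (left_inv_of_mem (toFunₗ_mem f))]
    split_ifs with h
    · rfl
    · simpa [apply_out (left_inv_of_mem (toFunₗ_mem f))] using h
  rw [eq_sum_normElem _ _ _ hf]
  exact Submodule.sum_mem _ fun q _ => Submodule.smul_mem _ _ (Submodule.subset_span ⟨_, rfl⟩)

theorem normElem_apply_self_ne_zero (g : G) : toFunₗ H (normElem H g) g ≠ 0 := by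
  classical
  rw [toFunₗ_normElem_apply, if_pos (mem_doubleCoset_self g), mul_one]
  exact one_div_ne_zero (numRightCosets_ne_zero g)

theorem mem_of_normElem_apply_ne_zero {g γ : G} (h : toFunₗ H (normElem H g) γ ≠ 0) :
    g ∈ DoubleCoset.doubleCoset γ H H := by
  classical
  rw [toFunₗ_normElem_apply] at h
  by_contra h'
  exact h (by rw [if_neg h', mul_zero])

end

end RightCosetExpansion

end HeckePair

namespace NFHecke

open HeckePair

variable {K : Type v} [Field K] [NumberField K]

/-! ### Double cosets in P_K and their right cosets. -/

section Orbits

theorem mem_PO {p : PK K} : p ∈ PO K ↔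
    (∃ c : 𝓞 K, algebraMap (𝓞 K) K c = p.y) ∧
      ∃ u : (𝓞 K)ˣ, algebraMap (𝓞 K) K u = (p.x : K) := by
  constructor
  · rintro ⟨q, rfl⟩
    exact ⟨⟨q.y, rfl⟩, ⟨q.x, rfl⟩⟩
  · rintro ⟨⟨c, hc⟩, u, hu⟩
    exact ⟨⟨c, u⟩, AxB.ext hc (Units.ext hu)⟩

theorem mk_mem_PO (c : 𝓞 K) (u : (𝓞 K)ˣ) :
    (⟨algebraMap (𝓞 K) K c, Units.map (algebraMap (𝓞 K) K : 𝓞 K →* K) u⟩ : PK K) ∈ PO K :=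
  ⟨⟨c, u⟩, rfl⟩

theorem cls_eq_cls {x y : K} : cls K x = cls K y ↔ ∃ c : 𝓞 K, algebraMap (𝓞 K) K c = x - y :=
  Submodule.Quotient.eq _

theorem cls_surjective : Function.Surjective (cls K) := Submodule.Quotient.mk_surjective _

theorem cls_add (x y : K) : cls K (x + y) = cls K x + cls K y := rfl

theorem units_smul_cls (u : (𝓞 K)ˣ) (x : K) :
    u • cls K x = cls K (algebraMap (𝓞 K) K u * x) := by
  rw [Units.smul_def, ← Algebra.smul_def]
  rfl

theorem cls_add_algebraMap (x : K) (c : 𝓞 K) : cls K (x + algebraMap (𝓞 K) K c) = cls K x :=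
  cls_eq_cls.2 ⟨c, by ring⟩

/-- Two elements of `P_K` with entries related as below have the same double coset. -/
theorem normElem_eq {p q : PK K} (c d : 𝓞 K) (u v : (𝓞 K)ˣ)
    (hx : (q.x : K) = algebraMap (𝓞 K) K u * p.x * algebraMap (𝓞 K) K v)
    (hy : q.y = algebraMap (𝓞 K) K d +
      (p.y + algebraMap (𝓞 K) K c * p.x) * algebraMap (𝓞 K) K v) :
    normElem (PO K) p = normElem (PO K) q := by
  rw [← normElem_mul_mul (mk_mem_PO c u) p (mk_mem_PO d v)]
  congr 1
  refine AxB.ext hy.symm (Units.ext hx.symm)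

theorem exists_of_mem_doubleCoset {p q : PK K}
    (h : q ∈ DoubleCoset.doubleCoset p (PO K) (PO K)) : ∃ (c d : 𝓞 K) (u v : (𝓞 K)ˣ),
      (q.x : K) = algebraMap (𝓞 K) K u * p.x * algebraMap (𝓞 K) K v ∧
      q.y = algebraMap (𝓞 K) K d +
        (p.y + algebraMap (𝓞 K) K c * p.x) * algebraMap (𝓞 K) K v := by
  obtain ⟨_, ⟨h', rfl⟩, _, ⟨k, rfl⟩, rfl⟩ := DoubleCoset.mem_doubleCoset.1 h
  exact ⟨h'.y, k.y, h'.x, k.x, rfl, rfl⟩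

theorem algebraMap_coe_ne_zero (a : (𝓞 K)⁰) : algebraMap (𝓞 K) K a ≠ 0 := by simp

theorem diag_x (a : (𝓞 K)⁰) : ((diag a).x : K) = algebraMap (𝓞 K) K a := rfl
theorem diag_y (a : (𝓞 K)⁰) : (diag a).y = 0 := rfl

/-- The matrix `!![1, y; 0, a]` for a nonzero integer `a`. -/
noncomputable def upper (y : K) (a : (𝓞 K)⁰) : PK K := ⟨y, (diag a).x⟩

theorem unip_mul_inv (y y' : K) : unip y * (unip y')⁻¹ = unip (y - y') := by
  ext
  · simp [unip, AxB.mul_y, AxB.inv_y, AxB.inv_x]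
    ring
  · simp [unip, AxB.mul_x, AxB.inv_x]

theorem unip_mem_PO {y : K} : unip y ∈ PO K ↔ ∃ c : 𝓞 K, algebraMap (𝓞 K) K c = y := by
  rw [mem_PO]
  exact ⟨fun h => h.1, fun h => ⟨h, 1, by simp [unip]⟩⟩

/-- A set of representatives of the right cosets in the double coset of `unip x`. -/
noncomputable def orbitRep (r : KModO K) (q : (𝓞 K)ˣ ⧸ MulAction.stabilizer (𝓞 K)ˣ r) : K :=
  (cls_surjective (MulAction.ofQuotientStabilizer (𝓞 K)ˣ r q)).choose

theorem cls_orbitRep (r : KModO K) (q : (𝓞 K)ˣ ⧸ MulAction.stabilizer (𝓞 K)ˣ r) :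
    cls K (orbitRep r q) = MulAction.ofQuotientStabilizer (𝓞 K)ˣ r q :=
  (cls_surjective (MulAction.ofQuotientStabilizer (𝓞 K)ˣ r q)).choose_spec

theorem exists_orbitRep (x : K) (q : (𝓞 K)ˣ ⧸ MulAction.stabilizer (𝓞 K)ˣ (cls K x)) :
    ∃ (u : (𝓞 K)ˣ) (c : 𝓞 K),
      orbitRep (cls K x) q = algebraMap (𝓞 K) K c + algebraMap (𝓞 K) K u * x := by
  induction q using Quotient.inductionOn with
  | h u =>
    have h : cls K (orbitRep (cls K x) (Quotient.mk _ u)) = u • cls K x :=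
      cls_orbitRep (cls K x) (Quotient.mk _ u)
    rw [units_smul_cls, cls_eq_cls] at h
    obtain ⟨c, hc⟩ := h
    exact ⟨u, c, by rw [hc]; ring⟩

/-- Right multiplication by k carries the right coset of `unip x` to that of `unip (k.x * x)`, and
the right coset of `unip z` remembers exactly the class of z in K/𝓞. Hence the right cosets
correspond to the unit orbit of the class of x. -/
theorem unip_transversal (x : K) :
    numRightCosets (PO K) (unip x) =
        Fintype.card ((𝓞 K)ˣ ⧸ MulAction.stabilizer (𝓞 K)ˣ (cls K x)) ∧
      doubleCosetFun (PO K) (unip x) =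
        ∑ q, rightCosetFun (PO K) (unip (orbitRep (cls K x) q)) := by
  refine doubleCoset_transversal _ ?_ ?_ ?_
  · intro i j h
    rw [unip_mul_inv, unip_mem_PO, ← cls_eq_cls, cls_orbitRep, cls_orbitRep] at h
    exact MulAction.injective_ofQuotientStabilizer _ _ h
  · intro q
    obtain ⟨u, c, h⟩ := exists_orbitRep x q
    rw [DoubleCoset.mem_doubleCoset]
    refine ⟨_, mk_mem_PO 0 u⁻¹, _, mk_mem_PO c u, ?_⟩
    ext
    · simp [unip, AxB.mul_y, h, mul_comm]
    · simp [unip, AxB.mul_x]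
  · rintro _ ⟨k, rfl⟩
    refine ⟨Quotient.mk _ k.x, ?_⟩
    have h : cls K (orbitRep (cls K x) (Quotient.mk _ k.x)) = k.x • cls K x :=
      cls_orbitRep (cls K x) (Quotient.mk _ k.x)
    rw [units_smul_cls, cls_eq_cls] at h
    obtain ⟨c, hc⟩ := h
    rw [mem_PO]
    refine ⟨⟨k.y - c, ?_⟩, k.x, ?_⟩
    · simp [unip, AxB.mul_y, AxB.inv_y, AxB.inv_x, AxB.map_x, AxB.map_y, hc]
      ring
    · simp [unip, AxB.mul_x, AxB.inv_x, AxB.map_x]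

theorem numR_cls (x : K) : numR (cls K x) = numRightCosets (PO K) (unip x) := rfl

theorem numR_eq_card (r : KModO K) :
    numR r = Fintype.card ((𝓞 K)ˣ ⧸ MulAction.stabilizer (𝓞 K)ˣ r) := by
  obtain ⟨x, rfl⟩ := cls_surjective r
  exact (unip_transversal x).1

theorem theta_cls (x : K) : theta (cls K x) = normElem (PO K) (unip x) := rfl

theorem toFunₗ_theta (r : KModO K) : toFunₗ (PO K) (theta r) =
    ∑ q, (1 / (numR r : ℂ)) • rightCosetFun (PO K) (unip (orbitRep r q)) := by
  obtain ⟨x, rfl⟩ := cls_surjective r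
  rw [theta_cls, normElem, map_smul, toFunₗ_doubleCosetElem, (unip_transversal x).2,
    Finset.smul_sum, numR_cls]

/-- Right multiplication produces any integral upper entry, while left multiplication changes that
entry by multiples of a; units on the diagonal are absorbed on the left. -/
theorem diag_transversal (a : (𝓞 K)⁰) :
    numRightCosets (PO K) (diag a) = Fintype.card (𝓞 K ⧸ Ideal.span {(a : 𝓞 K)}) ∧
      doubleCosetFun (PO K) (diag a) =
        ∑ b : 𝓞 K ⧸ Ideal.span {(a : 𝓞 K)},
          rightCosetFun (PO K) (upper (algebraMap (𝓞 K) K b.out) a) := by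
  have ha := algebraMap_coe_ne_zero a
  refine doubleCoset_transversal _ ?_ ?_ ?_
  · intro i j h
    obtain ⟨⟨c, hc⟩, -⟩ := mem_PO.1 h
    rw [← Quotient.out_eq i, ← Quotient.out_eq j]
    refine (Submodule.Quotient.eq _).2 (Ideal.mem_span_singleton.2 ⟨c, ?_⟩)
    apply FaithfulSMul.algebraMap_injective (𝓞 K) K
    rw [map_mul, hc, map_sub]
    simp [upper, AxB.mul_y, AxB.inv_y, AxB.inv_x, diag_x]
    field_simp
    ring
  · intro q
    rw [DoubleCoset.mem_doubleCoset]
    refine ⟨1, (PO K).one_mem, _, mk_mem_PO q.out 1, ?_⟩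
    ext
    · simp [upper, AxB.mul_y, diag_y]
    · simp [upper, AxB.mul_x]
  · rintro _ ⟨k, rfl⟩
    refine ⟨Quotient.mk _ k.y, ?_⟩
    have h : Quotient.mk _ (Quotient.mk _ k.y).out = (Quotient.mk _ k.y :
        𝓞 K ⧸ Ideal.span {(a : 𝓞 K)}) := Quotient.out_eq _
    obtain ⟨c, hc⟩ := Ideal.mem_span_singleton.1 ((Submodule.Quotient.eq _).1 h)
    have hc' := congrArg (algebraMap (𝓞 K) K) hc
    rw [map_sub, map_mul] at hc'
    rw [mem_PO]
    refine ⟨⟨-c, ?_⟩, k.x, ?_⟩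
    · simp only [upper, AxB.mul_y, AxB.inv_y, AxB.inv_x, AxB.map_y, diag_y,
        Units.val_inv_eq_inv_val, diag_x, map_neg]
      rw [sub_eq_iff_eq_add.1 hc']
      field_simp
      ring
    · simp only [upper, AxB.mul_x, AxB.inv_x, AxB.map_x, Units.val_mul,
        Units.val_inv_eq_inv_val, diag_x, Units.coe_map, MonoidHom.coe_coe]
      field_simp

theorem normN_eq_card (a : (𝓞 K)⁰) :
    normN a = Fintype.card (𝓞 K ⧸ Ideal.span {(a : 𝓞 K)}) := Nat.card_eq_fintype_card

theorem normN_pos (a : (𝓞 K)⁰) : 0 < normN a := by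
  rw [normN_eq_card]
  exact Fintype.card_pos

theorem normN_mul (a b : (𝓞 K)⁰) : normN (a * b) = normN a * normN b := by
  change Ideal.absNorm (Ideal.span {((a : 𝓞 K) * (b : 𝓞 K))}) =
    Ideal.absNorm (Ideal.span {(a : 𝓞 K)}) * Ideal.absNorm (Ideal.span {(b : 𝓞 K)})
  rw [← map_mul, Ideal.span_singleton_mul_span_singleton]

/-- The square root of `N_a`. -/
noncomputable def sqrtN (a : (𝓞 K)⁰) : ℂ := (Real.sqrt (normN a) : ℝ)

theorem sqrtN_ne_zero (a : (𝓞 K)⁰) : sqrtN a ≠ 0 := by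
  rw [sqrtN, Complex.ofReal_ne_zero, Real.sqrt_ne_zero']
  exact_mod_cast normN_pos a

theorem sqrtN_mul_self (a : (𝓞 K)⁰) : sqrtN a * sqrtN a = normN a := by
  rw [sqrtN, ← Complex.ofReal_mul, Real.mul_self_sqrt (Nat.cast_nonneg _), Complex.ofReal_natCast]

theorem sqrtN_mul (a b : (𝓞 K)⁰) : sqrtN (a * b) = sqrtN a * sqrtN b := by
  rw [sqrtN, normN_mul, Nat.cast_mul, Real.sqrt_mul (Nat.cast_nonneg _), Complex.ofReal_mul]
  rfl

theorem mu_eq (a : (𝓞 K)⁰) : mu a = (sqrtN a)⁻¹ • doubleCosetElem (PO K) (diag a) := by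
  rw [mu, sqrtN, one_div, Complex.ofReal_inv]

theorem mu_eq_normElem (a : (𝓞 K)⁰) : mu a = sqrtN a • normElem (PO K) (diag a) := by
  have h := sqrtN_ne_zero a
  rw [mu_eq, normElem, (diag_transversal a).1, ← normN_eq_card, ← sqrtN_mul_self, smul_smul]
  congr 1
  field_simp

theorem toFunₗ_mu (a : (𝓞 K)⁰) : toFunₗ (PO K) (mu a) = ∑ b : 𝓞 K ⧸ Ideal.span {(a : 𝓞 K)},
    (sqrtN a)⁻¹ • rightCosetFun (PO K) (upper (algebraMap (𝓞 K) K b.out) a) := by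
  rw [mu_eq, map_smul, toFunₗ_doubleCosetElem, (diag_transversal a).2, Finset.smul_sum]

/-- Conjugating an integral matrix by `(diag a)⁻¹` multiplies its upper entry by a and so stays
integral: the double coset is a single right coset. -/
theorem diag_inv_transversal (a : (𝓞 K)⁰) :
    numRightCosets (PO K) (diag a)⁻¹ = 1 ∧
      doubleCosetFun (PO K) (diag a)⁻¹ = ∑ _ : Unit, rightCosetFun (PO K) (diag a)⁻¹ := by
  refine doubleCoset_transversal (fun _ : Unit => (diag a)⁻¹) (fun _ _ _ => rfl)
    (fun _ => mem_doubleCoset_self _) ?_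
  rintro _ ⟨k, rfl⟩
  have ha := algebraMap_coe_ne_zero a
  refine ⟨(), mem_PO.2 ⟨⟨k.y * a, ?_⟩, k.x, ?_⟩⟩
  · simp [AxB.mul_y, AxB.inv_y, diag_y, AxB.map_y, diag_x]
  · simp [AxB.mul_x, AxB.inv_x, AxB.map_x]

theorem star_mu_eq (a : (𝓞 K)⁰) :
    star (mu a) = (sqrtN a)⁻¹ • doubleCosetElem (PO K) (diag a)⁻¹ := by
  rw [mu_eq, star_smul, star_doubleCosetElem, sqrtN, ← Complex.ofReal_inv]
  congr 1
  exact Complex.conj_ofReal _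

theorem star_mu_eq_normElem (a : (𝓞 K)⁰) :
    star (mu a) = (sqrtN a)⁻¹ • normElem (PO K) (diag a)⁻¹ := by
  rw [star_mu_eq, normElem, (diag_inv_transversal a).1, Nat.cast_one, div_one, one_smul]

theorem toFunₗ_star_mu (a : (𝓞 K)⁰) : toFunₗ (PO K) (star (mu a)) =
    ∑ _ ∈ ({()} : Finset Unit), (sqrtN a)⁻¹ • rightCosetFun (PO K) (diag a)⁻¹ := by
  rw [star_mu_eq, map_smul, toFunₗ_doubleCosetElem, (diag_inv_transversal a).2]
  simp

theorem star_mu_mul_normElem (a : (𝓞 K)⁰) (p : PK K) :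
    star (mu a) * normElem (PO K) p = (sqrtN a)⁻¹ • normElem (PO K) ((diag a)⁻¹ * p) := by
  rw [mul_normElem _ _ _ (toFunₗ_star_mu a) p, Finset.sum_singleton]

theorem theta_mul_normElem (r : KModO K) (p : PK K) : theta r * normElem (PO K) p =
    ∑ q, (1 / (numR r : ℂ)) • normElem (PO K) (unip (orbitRep r q) * p) :=
  mul_normElem _ _ _ (toFunₗ_theta r) p

theorem mu_mul_normElem (a : (𝓞 K)⁰) (p : PK K) : mu a * normElem (PO K) p =
    ∑ b : 𝓞 K ⧸ Ideal.span {(a : 𝓞 K)},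
      (sqrtN a)⁻¹ • normElem (PO K) (upper (algebraMap (𝓞 K) K b.out) a * p) :=
  mul_normElem _ _ _ (toFunₗ_mu a) p

/-! ### Verification of the relations in the Hecke algebra. -/

theorem numR_ne_zero (r : KModO K) : (numR r : ℂ) ≠ 0 := by
  rw [numR_eq_card, Nat.cast_ne_zero]
  exact Fintype.card_ne_zero

theorem sum_orbit_const {M : Type*} [AddCommGroup M] [Module ℂ M] (r : KModO K)
    (x : M) : ∑ _ : (𝓞 K)ˣ ⧸ MulAction.stabilizer (𝓞 K)ˣ r, (1 / (numR r : ℂ)) • x = x := by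
  rw [Finset.sum_const, Finset.card_univ, ← numR_eq_card, ← Nat.cast_smul_eq_nsmul ℂ, smul_smul,
    mul_one_div_cancel (numR_ne_zero r), one_smul]

theorem sum_quotient_const {M : Type*} [AddCommGroup M] [Module ℂ M] (a : (𝓞 K)⁰) (x : M) :
    ∑ _ : 𝓞 K ⧸ Ideal.span {(a : 𝓞 K)}, x = (sqrtN a * sqrtN a) • x := by
  rw [Finset.sum_const, Finset.card_univ, ← normN_eq_card, ← Nat.cast_smul_eq_nsmul ℂ,
    sqrtN_mul_self]

/-- Passing from x to u x is conjugation by a diagonal unit matrix, which commutes with the diagonal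
matrix p. All terms of the product therefore lie in one double coset. -/
theorem theta_mul_normElem_of_y_eq_zero (x : K) {p : PK K} (hp : p.y = 0) :
    theta (cls K x) * normElem (PO K) p = normElem (PO K) (unip x * p) := by
  rw [theta_mul_normElem]
  refine Eq.trans (Finset.sum_congr rfl fun q _ => ?_) (sum_orbit_const (cls K x) _)
  obtain ⟨u, c, h⟩ := exists_orbitRep x q
  have hu : algebraMap (𝓞 K) K (u⁻¹ : (𝓞 K)ˣ) * algebraMap (𝓞 K) K u = 1 := by
    rw [← map_mul, Units.inv_mul, map_one]
  rw [← normElem_eq (p := unip x * p) (c * (u⁻¹ : (𝓞 K)ˣ)) 0 u⁻¹ u]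
  · simp only [AxB.mul_x, unip, one_mul]
    linear_combination -(p.x : K) * hu
  · simp only [AxB.mul_x, AxB.mul_y, unip, one_mul, hp, h, map_zero, map_mul]
    linear_combination -(algebraMap (𝓞 K) K c * p.x) * hu

theorem mu_mul_mu (a b : (𝓞 K)⁰) : mu a * mu b = mu (a * b) := by
  rw [mu_eq_normElem b, mul_smul_comm, mu_mul_normElem, mu_eq_normElem, sqrtN_mul]
  -- The upper entry of the product is an integer, removable by an integral unipotent on the right,
  -- so all N_a terms coincide.
  have h : ∀ i : 𝓞 K ⧸ Ideal.span {(a : 𝓞 K)},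
      normElem (PO K) (upper (algebraMap (𝓞 K) K i.out) a * diag b) =
        normElem (PO K) (diag (a * b)) := fun i => by
    rw [← normElem_eq (p := diag (a * b)) 0 (i.out * b) 1 1]
    · simp [AxB.mul_x, upper, diag_x]
    · simp [AxB.mul_y, upper, diag_x, diag_y]
  simp only [h]
  rw [sum_quotient_const, smul_smul, smul_smul]
  congr 1
  have := sqrtN_ne_zero a
  field_simp

theorem star_mu_mul_mu (a : (𝓞 K)⁰) : star (mu a) * mu a = 1 := by
  nth_rw 2 [mu_eq_normElem]
  rw [mul_smul_comm, star_mu_mul_normElem, inv_mul_cancel, normElem_one, smul_smul,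
    mul_inv_cancel₀ (sqrtN_ne_zero a), one_smul]

theorem theta_zero : theta (0 : KModO K) = 1 := normElem_one

theorem sqrtN_eq_of_unit {a b : (𝓞 K)⁰} (u : (𝓞 K)ˣ) (h : (a : 𝓞 K) = u * b) :
    sqrtN a = sqrtN b := by
  have : Ideal.span {(a : 𝓞 K)} = Ideal.span {(b : 𝓞 K)} := by
    rw [h, Ideal.span_singleton_mul_left_unit u.isUnit]
  rw [sqrtN, sqrtN, normN, normN, this]

theorem mu_of_isUnit {a : (𝓞 K)⁰} (ha : IsUnit (a : 𝓞 K)) : mu a = 1 := by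
  obtain ⟨u, hu⟩ := ha
  have h1 : sqrtN a = 1 := by
    rw [sqrtN_eq_of_unit (b := 1) u (by simp [hu])]
    -- By multiplicativity `sqrtN 1` is a nonzero idempotent, hence 1.
    have h := sqrtN_mul (1 : (𝓞 K)⁰) 1
    rw [one_mul] at h
    exact mul_left_cancel₀ (sqrtN_ne_zero 1) (by rw [← h, mul_one])
  rw [mu_eq_normElem, h1, one_smul, ← normElem_one]
  symm
  refine normElem_eq 0 0 u 1 ?_ ?_
  · simp [diag_x, AxB.one_x, hu]
  · simp [diag_y, AxB.one_y]

theorem theta_smul (r : KModO K) (w : (𝓞 K)ˣ) : theta (w • r) = theta r := by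
  obtain ⟨x, rfl⟩ := cls_surjective r
  rw [units_smul_cls, theta_cls, theta_cls]
  symm
  refine normElem_eq 0 0 w⁻¹ w ?_ ?_
  · simp [unip]
  · simp [unip, mul_comm]

theorem star_theta (r : KModO K) : star (theta r) = theta r := by
  obtain ⟨x, rfl⟩ := cls_surjective r
  have h : doubleCosetElem (PO K) (unip x)⁻¹ = doubleCosetElem (PO K) (unip x) := by
    have : DoubleCoset.doubleCoset (unip x)⁻¹ (PO K) (PO K) =
        DoubleCoset.doubleCoset (unip x) (PO K) (PO K) := by
      refine (DoubleCoset.doubleCoset_eq_of_mem (DoubleCoset.mem_doubleCoset.2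
        ⟨_, mk_mem_PO 0 (-1), _, mk_mem_PO 0 (-1), ?_⟩))
      ext
      · simp [unip, AxB.mul_y, AxB.inv_y]
      · simp [unip, AxB.mul_x, AxB.inv_x]
    exact toFunₗ_injective (by simp only [toFunₗ_doubleCosetElem, doubleCosetFun, this])
  rw [theta_cls, normElem, star_smul, star_doubleCosetElem, h]
  congr 1
  simp

theorem theta_mul_theta (r s : KModO K) : theta r * theta s =
    ((1 / (numR r : ℂ)) * (1 / (numR s : ℂ))) •
      ∑ u : (𝓞 K)ˣ ⧸ MulAction.stabilizer (𝓞 K)ˣ r,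
        ∑ v : (𝓞 K)ˣ ⧸ MulAction.stabilizer (𝓞 K)ˣ s,
          theta (MulAction.ofQuotientStabilizer (𝓞 K)ˣ r u +
            MulAction.ofQuotientStabilizer (𝓞 K)ˣ s v) := by
  rw [mul_eq_sum_normElem _ _ _ _ _ _ (toFunₗ_theta r) (toFunₗ_theta s), Finset.smul_sum]
  refine Finset.sum_congr rfl fun u _ => ?_
  rw [Finset.smul_sum]
  refine Finset.sum_congr rfl fun v _ => ?_
  rw [← cls_orbitRep, ← cls_orbitRep, ← cls_add, theta_cls]
  congr 2
  ext
  · simp [unip, AxB.mul_y, add_comm]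
  · simp [unip, AxB.mul_x]

theorem divClass_mk (a : (𝓞 K)⁰) (x : K) (c : 𝓞 K) :
    divClass a x (Ideal.Quotient.mk _ c) =
      cls K ((x + algebraMap (𝓞 K) K c) / algebraMap (𝓞 K) K a) := rfl

/-- The matrix identity behind it: `upper b a * (unip x * (diag a)⁻¹) = unip ((x + b) / a)`. -/
theorem mu_mul_theta_mul_star_mu (a : (𝓞 K)⁰) (x : K) :
    mu a * theta (cls K x) * star (mu a) =
      (1 / (normN a : ℂ)) • ∑ b : 𝓞 K ⧸ Ideal.span {(a : 𝓞 K)}, theta (divClass a x b) := by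
  have ha := algebraMap_coe_ne_zero a
  rw [star_mu_eq_normElem, mul_smul_comm, mul_assoc, theta_mul_normElem_of_y_eq_zero,
    mu_mul_normElem, Finset.smul_sum, Finset.smul_sum]
  · refine Finset.sum_congr rfl fun b _ => ?_
    have hb : divClass a x b =
        cls K ((x + algebraMap (𝓞 K) K b.out) / algebraMap (𝓞 K) K a) := by
      rw [← divClass_mk]
      exact congrArg _ (Quotient.out_eq b).symm
    rw [hb, theta_cls, smul_smul, ← sqrtN_mul_self]
    congr 1
    · field_simp
    · congr 1
      ext
      · simp [unip, upper, AxB.mul_y, AxB.mul_x, AxB.inv_y, AxB.inv_x, diag_x, diag_y]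
        field_simp
      · simp [unip, upper, AxB.mul_x, AxB.inv_x]
  · simp [AxB.inv_y, diag_y]

theorem relations_mu_theta : Relations (K := K) mu theta where
  mu_unit _ := mu_of_isUnit
  star_mu_mul_mu := star_mu_mul_mu
  mu_mul := mu_mul_mu
  theta_zero := theta_zero
  theta_smul := theta_smul
  star_theta := star_theta
  theta_mul := theta_mul_theta
  mu_theta_star_mu := mu_mul_theta_mul_star_mu

/-! ### The monomials as a linear basis. -/

/-- The matrix `!![1, x * b; 0, b / a]`. -/
noncomputable def monomialRep (a : (𝓞 K)⁰) (x : K) (b : (𝓞 K)⁰) : PK K :=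
  (diag a)⁻¹ * (unip x * diag b)

theorem monomialRep_x (a : (𝓞 K)⁰) (x : K) (b : (𝓞 K)⁰) :
    ((monomialRep a x b).x : K) = algebraMap (𝓞 K) K b / algebraMap (𝓞 K) K a := by
  simp [monomialRep, AxB.mul_x, AxB.inv_x, unip, diag_x]
  ring

theorem monomialRep_y (a : (𝓞 K)⁰) (x : K) (b : (𝓞 K)⁰) :
    (monomialRep a x b).y = x * algebraMap (𝓞 K) K b := by
  simp [monomialRep, AxB.mul_y, AxB.inv_y, unip, diag_x, diag_y]

/-- No sum survives: θ multiplies the diagonal matrix `diag b` without splitting, and μ_a^* is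
supported on one right coset. -/
theorem monomial_eq (a : (𝓞 K)⁰) (x : K) (b : (𝓞 K)⁰) :
    star (mu a) * theta (cls K x) * mu b =
      ((sqrtN a)⁻¹ * sqrtN b) • normElem (PO K) (monomialRep a x b) := by
  rw [mul_assoc, mu_eq_normElem b, mul_smul_comm, theta_mul_normElem_of_y_eq_zero _ (diag_y b),
    mul_smul_comm, star_mu_mul_normElem, smul_smul, mul_comm, monomialRep]

theorem monomial_coeff_ne_zero (a b : (𝓞 K)⁰) : (sqrtN a)⁻¹ * sqrtN b ≠ 0 :=
  mul_ne_zero (inv_ne_zero (sqrtN_ne_zero a)) (sqrtN_ne_zero b)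

theorem mem_doubleCoset_of_monomial_apply_ne_zero {a b a' b' : (𝓞 K)⁰} {x x' : K}
    (h : toFunₗ (PO K) (star (mu a') * theta (cls K x') * mu b') (monomialRep a x b) ≠ 0) :
    monomialRep a' x' b' ∈ DoubleCoset.doubleCoset (monomialRep a x b) (PO K) (PO K) := by
  rw [monomial_eq, map_smul, Pi.smul_apply] at h
  exact mem_of_normElem_apply_ne_zero (right_ne_zero_of_smul h)

theorem monomial_apply_self_ne_zero (a b : (𝓞 K)⁰) (x : K) :
    toFunₗ (PO K) (star (mu a) * theta (cls K x) * mu b) (monomialRep a x b) ≠ 0 := by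
  rw [monomial_eq, map_smul, Pi.smul_apply]
  exact smul_ne_zero (monomial_coeff_ne_zero a b) (normElem_apply_self_ne_zero _)

theorem monomialRep_relation {a b a' b' : (𝓞 K)⁰} {x x' : K}
    (h : monomialRep a' x' b' ∈ DoubleCoset.doubleCoset (monomialRep a x b) (PO K) (PO K)) :
    ∃ (c d : 𝓞 K) (u v : (𝓞 K)ˣ), (a * b' : 𝓞 K) = u * v * (a' * b) ∧
      x' * algebraMap (𝓞 K) K b' = algebraMap (𝓞 K) K d +
        (x + algebraMap (𝓞 K) K c / algebraMap (𝓞 K) K a) * algebraMap (𝓞 K) K b *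
          algebraMap (𝓞 K) K v := by
  have ha := algebraMap_coe_ne_zero a
  have ha' := algebraMap_coe_ne_zero a'
  obtain ⟨c, d, u, v, hx, hy⟩ := exists_of_mem_doubleCoset h
  rw [monomialRep_x, monomialRep_x] at hx
  rw [monomialRep_x, monomialRep_y, monomialRep_y] at hy
  refine ⟨c, d, u, v, ?_, ?_⟩
  · apply FaithfulSMul.algebraMap_injective (𝓞 K) K
    simp only [map_mul]
    field_simp at hx
    linear_combination hx
  · rw [hy]
    ring

/-- Beyond `normElem`, the scalars must agree. They do, because a b' and a' b differ by a unit and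
so have the same norm. -/
theorem monomial_eq_of_mem_doubleCoset {a b a' b' : (𝓞 K)⁰} {x x' : K}
    (h : monomialRep a' x' b' ∈ DoubleCoset.doubleCoset (monomialRep a x b) (PO K) (PO K)) :
    star (mu a') * theta (cls K x') * mu b' = star (mu a) * theta (cls K x) * mu b := by
  rw [monomial_eq, monomial_eq, normElem_congr (DoubleCoset.doubleCoset_eq_of_mem h)]
  congr 1
  obtain ⟨c, d, u, v, e, -⟩ := monomialRep_relation h
  have h1 := sqrtN_eq_of_unit (a := a * b') (b := a' * b) (u * v) (by simpa using e)
  rw [sqrtN_mul, sqrtN_mul] at h1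
  have ha := sqrtN_ne_zero a
  have ha' := sqrtN_ne_zero a'
  field_simp
  linear_combination h1

theorem exists_monomialRep (p : PK K) : ∃ a x b, monomialRep a x b = p := by
  obtain ⟨b, a, ha, h⟩ := IsFractionRing.div_surjective (A := 𝓞 K) (p.x : K)
  have hb : b ≠ 0 := by
    rintro rfl
    exact p.x.ne_zero (by rw [← h]; simp)
  refine ⟨⟨a, ha⟩, p.y / algebraMap (𝓞 K) K b, ⟨b, mem_nonZeroDivisors_of_ne_zero hb⟩, ?_⟩
  ext
  · rw [monomialRep_y]
    exact div_mul_cancel₀ _ (by simpa using hb)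
  · rw [monomialRep_x]
    exact h

theorem span_monomials : Submodule.span ℂ (monomials K) = ⊤ := by
  rw [eq_top_iff, ← span_normElem, Submodule.span_le]
  rintro _ ⟨p, rfl⟩
  obtain ⟨a, x, b, rfl⟩ := exists_monomialRep p
  have h : normElem (PO K) (monomialRep a x b) =
      ((sqrtN a)⁻¹ * sqrtN b)⁻¹ • (star (mu a) * theta (cls K x) * mu b) := by
    rw [monomial_eq, smul_smul, inv_mul_cancel₀ (monomial_coeff_ne_zero a b), one_smul]
  rw [h]
  exact Submodule.smul_mem _ _ (Submodule.subset_span ⟨a, b, cls K x, rfl⟩)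

/-- Evaluation at `monomialRep a x b` isolates one coefficient: any monomial not vanishing there has
the same double coset, hence is the same element. -/
theorem linearIndependent_monomials :
    LinearIndependent ℂ (Subtype.val : monomials K → HeckeAlgebra (PO K)) := by
  rw [linearIndependent_iff']
  rintro s g hg ⟨_, a, b, r, rfl⟩ hi
  obtain ⟨x, rfl⟩ := cls_surjective r
  have h := congrFun (congrArg (toFunₗ (PO K)) hg) (monomialRep a x b)
  rw [map_sum, Finset.sum_apply, Finset.sum_eq_single _ _ (fun h => absurd hi h), map_smul,
    Pi.smul_apply, map_zero, Pi.zero_apply, smul_eq_mul] at h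
  · exact (mul_eq_zero.1 h).resolve_right (monomial_apply_self_ne_zero a b x)
  · rintro ⟨_, a', b', r', rfl⟩ _ hne
    obtain ⟨x', rfl⟩ := cls_surjective r'
    rw [map_smul, Pi.smul_apply]
    by_contra h'
    exact hne (Subtype.ext (monomial_eq_of_mem_doubleCoset
      (mem_doubleCoset_of_monomial_apply_ne_zero (right_ne_zero_of_smul h'))))

end Orbits

end NFHecke

/-! ### Sums over finite sets invariant under a group. -/

/-- Averaging over orbits does not change the sum over an invariant finite set. -/
theorem Finset.sum_orbit_average {G X M : Type*} [Group G] [MulAction G X]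
    [∀ s : X, Fintype (G ⧸ MulAction.stabilizer G s)] [AddCommGroup M] [Module ℂ M]
    (S : Finset X) (hS : ∀ (g : G), ∀ s ∈ S, g • s ∈ S) (F : X → M) :
    ∑ s ∈ S, (1 / (Fintype.card (G ⧸ MulAction.stabilizer G s) : ℂ)) •
      ∑ v : G ⧸ MulAction.stabilizer G s, F (MulAction.ofQuotientStabilizer G s v) =
    ∑ s ∈ S, F s := by
  classical
  have horb : ∀ s ∈ S, S.filter (fun s' => s' ∈ MulAction.orbit G s) =
      Finset.univ.image (MulAction.ofQuotientStabilizer G s) := by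
    intro s hs
    ext s'
    simp only [Finset.mem_filter, Finset.mem_image, Finset.mem_univ, true_and]
    constructor
    · rintro ⟨-, g, rfl⟩
      exact ⟨g, rfl⟩
    · rintro ⟨q, rfl⟩
      induction q using Quotient.inductionOn with
      | h g => exact ⟨hS g s hs, g, rfl⟩
  have hcard : ∀ s ∈ S, Fintype.card (G ⧸ MulAction.stabilizer G s) =
      (S.filter fun s' => s' ∈ MulAction.orbit G s).card := by
    intro s hs
    rw [horb s hs, Finset.card_image_of_injective _
      (MulAction.injective_ofQuotientStabilizer G s), Finset.card_univ]
  -- After the sums are interchanged, F s' is weighted by 1/|orbit of s'| once for each s in its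
  -- orbit, for a total weight of 1.
  have h1 : ∀ s ∈ S, (1 / (Fintype.card (G ⧸ MulAction.stabilizer G s) : ℂ)) •
      ∑ v : G ⧸ MulAction.stabilizer G s, F (MulAction.ofQuotientStabilizer G s v) =
      ∑ s' ∈ S, if s ∈ MulAction.orbit G s' then
        (1 / ((S.filter fun x => x ∈ MulAction.orbit G s').card : ℂ)) • F s' else 0 := by
    intro s hs
    rw [← Finset.sum_image (f := F) (g := MulAction.ofQuotientStabilizer G s)
      (fun _ _ _ _ e => MulAction.injective_ofQuotientStabilizer G s e), ← horb s hs,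
      Finset.smul_sum, Finset.sum_filter]
    refine Finset.sum_congr rfl fun s' _ => ?_
    rw [MulAction.mem_orbit_symm]
    split_ifs with h
    · rw [hcard s hs, MulAction.orbit_eq_iff.2 h]
    · rfl
  rw [Finset.sum_congr rfl h1, Finset.sum_comm]
  refine Finset.sum_congr rfl fun s' hs' => ?_
  rw [← Finset.sum_filter, Finset.sum_const, ← Nat.cast_smul_eq_nsmul ℂ, smul_smul,
    mul_one_div_cancel, one_smul]
  rw [Nat.cast_ne_zero, ← Nat.pos_iff_ne_zero, Finset.card_pos]
  exact ⟨s', Finset.mem_filter.2 ⟨hs', MulAction.mem_orbit_self s'⟩⟩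

theorem Finset.sum_smul_of_invariant {G X M : Type*} [Group G] [MulAction G X] [AddCommMonoid M]
    (S : Finset X) (hS : ∀ (g : G), ∀ s ∈ S, g • s ∈ S) (F : X → M) (g : G) :
    ∑ s ∈ S, F (g • s) = ∑ s ∈ S, F s := by
  refine Finset.sum_bij' (fun s _ => g • s) (fun s _ => g⁻¹ • s) (hS g) (hS g⁻¹) ?_ ?_ ?_ <;>
  simp

namespace NFHecke

open HeckePair

variable {K : Type v} [Field K] [NumberField K]

/-! ### Consequences of the relations in an arbitrary algebra. -/

theorem divClass_injective (a : (𝓞 K)⁰) (x : K) : Function.Injective (divClass a x) := by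
  intro b b' e
  obtain ⟨c, rfl⟩ := Ideal.Quotient.mk_surjective b
  obtain ⟨c', rfl⟩ := Ideal.Quotient.mk_surjective b'
  rw [divClass_mk, divClass_mk, cls_eq_cls] at e
  obtain ⟨d, hd⟩ := e
  rw [Ideal.Quotient.mk_eq_mk_iff_sub_mem, Ideal.mem_span_singleton]
  refine ⟨d, FaithfulSMul.algebraMap_injective (𝓞 K) K ?_⟩
  have ha := algebraMap_coe_ne_zero a
  rw [map_sub, map_mul, hd]
  field_simp
  ring

theorem divClass_mul (a : (𝓞 K)⁰) (x : K) (b : 𝓞 K ⧸ Ideal.span {(a : 𝓞 K)}) :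
    divClass a (algebraMap (𝓞 K) K a * x) b = cls K x + divClass a 0 b := by
  obtain ⟨c, rfl⟩ := Ideal.Quotient.mk_surjective b
  have ha := algebraMap_coe_ne_zero a
  rw [divClass_mk, divClass_mk, ← cls_add]
  congr 1
  field_simp
  ring

theorem units_smul_divClass (u : (𝓞 K)ˣ) (a : (𝓞 K)⁰) (c : 𝓞 K) :
    u • divClass a 0 (Ideal.Quotient.mk _ c) = divClass a 0 (Ideal.Quotient.mk _ (u * c)) := by
  rw [divClass_mk, divClass_mk, units_smul_cls]
  congr 1
  simp only [map_mul]
  ring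

namespace Relations

variable {A : Type w} [Ring A] [StarRing A] [Algebra ℂ A]
  {m : (𝓞 K)⁰ → A} {t : KModO K → A} (h : Relations m t)
include h

theorem mu_mul_star_mu (a : (𝓞 K)⁰) : m a * star (m a) =
    (1 / (normN a : ℂ)) • ∑ b : 𝓞 K ⧸ Ideal.span {(a : 𝓞 K)}, t (divClass a 0 b) := by
  rw [← h.mu_theta_star_mu a 0]
  have : cls K 0 = 0 := rfl
  rw [this, h.theta_zero, mul_one]

/-- Reindexing s as u s turns the argument into u (r + s), and t is constant on unit orbits. -/
theorem sum_theta_add_smul (r : KModO K) (u : (𝓞 K)ˣ) (S : Finset (KModO K))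
    (hS : ∀ (g : (𝓞 K)ˣ), ∀ s ∈ S, g • s ∈ S) :
    ∑ s ∈ S, t (u • r + s) = ∑ s ∈ S, t (r + s) := by
  rw [← S.sum_smul_of_invariant hS (fun s => t (u • r + s)) u]
  simp only [← smul_add, h.theta_smul]

/-- The product formula averages over the orbits of both r and s. Summing over an invariant set
absorbs the average over s, and the sums left over then no longer depend on the point in the orbit
of r. -/
theorem theta_mul_sum (r : KModO K) (S : Finset (KModO K))
    (hS : ∀ (g : (𝓞 K)ˣ), ∀ s ∈ S, g • s ∈ S) :
    t r * ∑ s ∈ S, t s = ∑ s ∈ S, t (r + s) := by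
  have h1 : ∀ s, t r * t s = ∑ u : (𝓞 K)ˣ ⧸ MulAction.stabilizer (𝓞 K)ˣ r, (1 / (numR r : ℂ)) •
      ((1 / (Fintype.card ((𝓞 K)ˣ ⧸ MulAction.stabilizer (𝓞 K)ˣ s) : ℂ)) •
        ∑ v : (𝓞 K)ˣ ⧸ MulAction.stabilizer (𝓞 K)ˣ s,
          t (MulAction.ofQuotientStabilizer (𝓞 K)ˣ r u +
            MulAction.ofQuotientStabilizer (𝓞 K)ˣ s v)) := fun s => by
    rw [h.theta_mul, ← numR_eq_card, Finset.smul_sum]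
    simp only [smul_smul]
  rw [Finset.mul_sum, Finset.sum_congr rfl fun s _ => h1 s, Finset.sum_comm,
    ← sum_orbit_const r (∑ s ∈ S, t (r + s))]
  refine Finset.sum_congr rfl fun u _ => ?_
  rw [← Finset.smul_sum, S.sum_orbit_average hS
    (fun s => t (MulAction.ofQuotientStabilizer (𝓞 K)ˣ r u + s))]
  congr 1
  induction u using Quotient.inductionOn with
  | h u => exact h.sum_theta_add_smul r u S hS

/-- By covariance `m a * star (m a)` is the average of t over S = a⁻¹𝓞/𝓞, and the right side is its
average over the translate of S by the class of x. Since S is unit-invariant, `theta_mul_sum`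
identifies the two. -/
theorem theta_mul_mu_mul_star_mu (a : (𝓞 K)⁰) (x : K) : t (cls K x) * (m a * star (m a)) =
    m a * t (cls K (algebraMap (𝓞 K) K a * x)) * star (m a) := by
  classical
  set S : Finset (KModO K) := Finset.univ.image (divClass a 0) with hS
  have hsum : ∀ F : KModO K → A, ∑ b : 𝓞 K ⧸ Ideal.span {(a : 𝓞 K)}, F (divClass a 0 b) =
      ∑ s ∈ S, F s := fun F => by
    rw [hS, Finset.sum_image fun _ _ _ _ e => divClass_injective a 0 e]
  rw [h.mu_mul_star_mu, h.mu_theta_star_mu, mul_smul_comm]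
  simp only [divClass_mul]
  rw [hsum t, hsum (fun s => t (cls K x + s)), h.theta_mul_sum]
  intro g s hs
  rw [hS, Finset.mem_image] at hs ⊢
  obtain ⟨b, -, rfl⟩ := hs
  obtain ⟨c, rfl⟩ := Ideal.Quotient.mk_surjective b
  exact ⟨_, Finset.mem_univ _, (units_smul_divClass g a c).symm⟩

/-- Multiplying the previous identity on the right by the isometry `m a` cancels `star (m a)`. -/
theorem theta_mul_mu (a : (𝓞 K)⁰) (x : K) :
    t (cls K x) * m a = m a * t (cls K (algebraMap (𝓞 K) K a * x)) := by
  have e := congrArg (· * m a) (h.theta_mul_mu_mul_star_mu a x)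
  simpa only [mul_assoc, h.star_mu_mul_mu, mul_one] using e

theorem star_mu_mul_theta (a : (𝓞 K)⁰) (x : K) :
    star (m a) * t (cls K x) = t (cls K (algebraMap (𝓞 K) K a * x)) * star (m a) := by
  have e := congrArg star (h.theta_mul_mu a x)
  simpa only [star_mul, h.star_theta] using e

theorem mu_comm (a b : (𝓞 K)⁰) : m a * m b = m b * m a := by
  rw [h.mu_mul, h.mu_mul, mul_comm]

theorem mu_eq_of_unit {a b : (𝓞 K)⁰} (u : (𝓞 K)ˣ) (e : (a : 𝓞 K) = u * b) : m a = m b := by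
  have hu : (u : 𝓞 K) ∈ (𝓞 K)⁰ := u.isUnit.mem_nonZeroDivisors
  have e' : a = ⟨u, hu⟩ * b := Subtype.ext e
  rw [e', ← h.mu_mul, h.mu_unit _ u.isUnit, one_mul]

/-- A common factor c can be inserted or cancelled, as in the fraction b/a; this allows two
monomials to be brought to a common denominator. -/
theorem star_mu_mul_theta_mul_mu_mul (a b c : (𝓞 K)⁰) (x : K) :
    star (m (c * a)) * t (cls K x) * m (c * b) =
      star (m a) * t (cls K (algebraMap (𝓞 K) K c * x)) * m b := by
  calc
    _ = star (m a) * (star (m c) * t (cls K x)) * (m c * m b) := by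
      rw [← h.mu_mul, ← h.mu_mul, star_mul]
      simp only [mul_assoc]
    _ = star (m a) * t (cls K (algebraMap (𝓞 K) K c * x)) * (star (m c) * m c) * m b := by
      rw [h.star_mu_mul_theta]
      simp only [mul_assoc]
    _ = _ := by rw [h.star_mu_mul_mu, mul_one]

/-- Moving t past `star (m a)` multiplies x by a, so to the right of `star (m a)` only x modulo a⁻¹𝓞
matters. -/
theorem star_mu_mul_theta_add (a : (𝓞 K)⁰) (x : K) (c : 𝓞 K) :
    star (m a) * t (cls K (x + algebraMap (𝓞 K) K c / algebraMap (𝓞 K) K a)) =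
      star (m a) * t (cls K x) := by
  have ha := algebraMap_coe_ne_zero a
  rw [h.star_mu_mul_theta, h.star_mu_mul_theta, mul_add, mul_div_cancel₀ _ ha, cls_add_algebraMap]

/-- `star (m a) * t r * m b` depends only on the double coset of `monomialRep a x b`. -/
theorem monomial_congr {a b a' b' : (𝓞 K)⁰} {x x' : K}
    (hd : monomialRep a' x' b' ∈ DoubleCoset.doubleCoset (monomialRep a x b) (PO K) (PO K)) :
    star (m a') * t (cls K x') * m b' = star (m a) * t (cls K x) * m b := by
  obtain ⟨c, d, u, v, e, hx⟩ := monomialRep_relation hd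
  have ha := algebraMap_coe_ne_zero a
  have ha' := algebraMap_coe_ne_zero a'
  have hb' := algebraMap_coe_ne_zero b'
  have e' := congrArg (algebraMap (𝓞 K) K) e
  simp only [map_mul] at e'
  have hu : algebraMap (𝓞 K) K (u⁻¹ : (𝓞 K)ˣ) * algebraMap (𝓞 K) K u = 1 := by
    rw [← map_mul, Units.inv_mul, map_one]
  have hv : algebraMap (𝓞 K) K (v⁻¹ : (𝓞 K)ˣ) * algebraMap (𝓞 K) K v = 1 := by
    rw [← map_mul, Units.inv_mul, map_one]
  -- Over the common denominator a a' the two arguments of t are x'/a and x/a'. The shift c/(a' a)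
  -- is invisible next to `star (m (a' * a))`, and it makes the remaining comparison possible next
  -- to `m (a' * b)`.
  set y : K := x / algebraMap (𝓞 K) K a' +
    algebraMap (𝓞 K) K c / algebraMap (𝓞 K) K (a' * a : (𝓞 K)⁰) with hy
  have h1 : t (cls K (x' / algebraMap (𝓞 K) K a)) * m (a' * b) = t (cls K y) * m (a' * b) := by
    have hcls : cls K (algebraMap (𝓞 K) K (a' * b : (𝓞 K)⁰) * (x' / algebraMap (𝓞 K) K a)) =
        u⁻¹ • cls K (algebraMap (𝓞 K) K (a' * b : (𝓞 K)⁰) * y) := by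
      rw [units_smul_cls, cls_eq_cls]
      -- Since a' b = u⁻¹ v⁻¹ a b', the left argument is u⁻¹ v⁻¹ x' b'; substituting for x' b' gives
      -- u⁻¹ v⁻¹ d plus u⁻¹ times the right argument.
      refine ⟨d * (u⁻¹ : (𝓞 K)ˣ) * (v⁻¹ : (𝓞 K)ˣ), ?_⟩
      have h2 : algebraMap (𝓞 K) K (a' * b : (𝓞 K)⁰) * y = algebraMap (𝓞 K) K b *
          (x + algebraMap (𝓞 K) K c / algebraMap (𝓞 K) K a) := by
        simp only [hy, Submonoid.coe_mul, map_mul]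
        field_simp
      have h3 : algebraMap (𝓞 K) K (a' * b : (𝓞 K)⁰) = algebraMap (𝓞 K) K (u⁻¹ : (𝓞 K)ˣ) *
          algebraMap (𝓞 K) K (v⁻¹ : (𝓞 K)ˣ) *
            (algebraMap (𝓞 K) K a * algebraMap (𝓞 K) K b') := by
        rw [e', Submonoid.coe_mul, map_mul]
        linear_combination (-algebraMap (𝓞 K) K a' * algebraMap (𝓞 K) K b) * hu -
          algebraMap (𝓞 K) K a' * algebraMap (𝓞 K) K b * algebraMap (𝓞 K) K (u⁻¹ : (𝓞 K)ˣ) *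
            algebraMap (𝓞 K) K u * hv
      have h4 : algebraMap (𝓞 K) K (a' * b : (𝓞 K)⁰) * (x' / algebraMap (𝓞 K) K a) =
          algebraMap (𝓞 K) K (u⁻¹ : (𝓞 K)ˣ) * algebraMap (𝓞 K) K (v⁻¹ : (𝓞 K)ˣ) *
            (x' * algebraMap (𝓞 K) K b') := by
        rw [h3]
        field_simp
      rw [h2, h4, hx, map_mul, map_mul]
      linear_combination -(algebraMap (𝓞 K) K (u⁻¹ : (𝓞 K)ˣ) * algebraMap (𝓞 K) K b *
        (x + algebraMap (𝓞 K) K c / algebraMap (𝓞 K) K a)) * hv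
    rw [h.theta_mul_mu, h.theta_mul_mu, hcls, h.theta_smul]
  calc
    _ = star (m (a * a')) * t (cls K (x' / algebraMap (𝓞 K) K a)) * m (a * b') := by
      rw [h.star_mu_mul_theta_mul_mu_mul, mul_div_cancel₀ _ ha]
    _ = star (m (a' * a)) * t (cls K (x / algebraMap (𝓞 K) K a')) * m (a' * b) := by
      rw [h.mu_eq_of_unit (a := a * b') (b := a' * b) (u * v) (by simpa using e), mul_assoc, h1,
        ← mul_assoc, mul_comm a, hy, h.star_mu_mul_theta_add]
    _ = _ := by rw [h.star_mu_mul_theta_mul_mu_mul, mul_div_cancel₀ _ ha']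

/-! ### The span of the monomials is closed under multiplication. -/

theorem theta_mul_mem_span {τ σ : A} (hτ : τ ∈ Submodule.span ℂ (Set.range t))
    (hσ : σ ∈ Submodule.span ℂ (Set.range t)) : τ * σ ∈ Submodule.span ℂ (Set.range t) := by
  have h1 := Submodule.mul_mem_mul hτ hσ
  rw [Submodule.span_mul_span] at h1
  refine Submodule.span_le.2 ?_ h1
  rintro _ ⟨_, ⟨r, rfl⟩, _, ⟨s, rfl⟩, rfl⟩
  change t r * t s ∈ _
  rw [h.theta_mul]
  exact Submodule.smul_mem _ _ (Submodule.sum_mem _ fun u _ => Submodule.sum_mem _ fun v _ =>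
    Submodule.subset_span ⟨_, rfl⟩)

/-- Division by b is possible in K, so `theta_mul_mu` can be read from right to left to move any t
to the left of `m b`. -/
theorem exists_mu_mul_eq (b : (𝓞 K)⁰) {τ : A} (hτ : τ ∈ Submodule.span ℂ (Set.range t)) :
    ∃ σ ∈ Submodule.span ℂ (Set.range t), m b * τ = σ * m b := by
  have hb := algebraMap_coe_ne_zero b
  induction hτ using Submodule.span_induction with
  | mem τ hτ =>
    obtain ⟨r, rfl⟩ := hτ
    obtain ⟨x, rfl⟩ := cls_surjective r
    refine ⟨_, Submodule.subset_span ⟨cls K (x / algebraMap (𝓞 K) K b), rfl⟩, ?_⟩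
    rw [h.theta_mul_mu, mul_div_cancel₀ _ hb]
  | zero => exact ⟨0, Submodule.zero_mem _, by simp⟩
  | add τ τ' _ _ h1 h2 =>
    obtain ⟨σ, hσ, e⟩ := h1
    obtain ⟨σ', hσ', e'⟩ := h2
    exact ⟨σ + σ', Submodule.add_mem _ hσ hσ', by rw [mul_add, add_mul, e, e']⟩
  | smul c τ _ h1 =>
    obtain ⟨σ, hσ, e⟩ := h1
    exact ⟨c • σ, Submodule.smul_mem _ _ hσ, by rw [mul_smul_comm, smul_mul_assoc, e]⟩

omit h in
theorem star_mu_mul_mul_mu_mem_span (m : (𝓞 K)⁰ → A) (t : KModO K → A) (a b : (𝓞 K)⁰) {τ : A}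
    (hτ : τ ∈ Submodule.span ℂ (Set.range t)) :
    star (m a) * τ * m b ∈ Submodule.span ℂ {f | ∃ a b r, f = star (m a) * t r * m b} := by
  induction hτ using Submodule.span_induction with
  | mem τ hτ =>
    obtain ⟨r, rfl⟩ := hτ
    exact Submodule.subset_span ⟨a, b, r, rfl⟩
  | zero => simp
  | add τ τ' _ _ h1 h2 =>
    rw [mul_add, add_mul]
    exact Submodule.add_mem _ h1 h2
  | smul c τ _ h1 =>
    rw [mul_smul_comm, smul_mul_assoc]
    exact Submodule.smul_mem _ _ h1

theorem monomial_mul_monomial_mem_span (a b c d : (𝓞 K)⁰) (r s : KModO K) :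
    star (m a) * t r * m b * (star (m c) * t s * m d) ∈
      Submodule.span ℂ {f | ∃ a b r, f = star (m a) * t r * m b} := by
  obtain ⟨x, rfl⟩ := cls_surjective r
  have hc := algebraMap_coe_ne_zero c
  have hE : m c * star (m c) ∈ Submodule.span ℂ (Set.range t) := by
    rw [h.mu_mul_star_mu]
    exact Submodule.smul_mem _ _ (Submodule.sum_mem _ fun b _ => Submodule.subset_span ⟨_, rfl⟩)
  obtain ⟨σ, hσ, e⟩ := h.exists_mu_mul_eq b
    (h.theta_mul_mem_span hE (Submodule.subset_span ⟨s, rfl⟩))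
  -- Inserting `star (m c) * m c` = 1 before `m b` lets `m c` commute past `m b` and meet `star (m
  -- c)`. Their product lies in the span of t, so no common divisor of b and c is needed.
  have key : star (m a) * t (cls K x) * m b * (star (m c) * t s * m d) =
      star (m (c * a)) * (t (cls K (x / algebraMap (𝓞 K) K c)) * σ) * m (b * d) := by
    calc
      _ = star (m a) * t (cls K x) * (star (m c) * m c) * m b * star (m c) * t s * m d := by
        rw [h.star_mu_mul_mu]
        simp only [mul_assoc, one_mul]
      _ = star (m a) * (t (cls K x) * star (m c)) * (m c * m b) * star (m c) * t s * m d := by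
        simp only [mul_assoc]
      _ = star (m a) * (star (m c) * t (cls K (x / algebraMap (𝓞 K) K c))) * (m b * m c) *
          star (m c) * t s * m d := by
        rw [h.star_mu_mul_theta, mul_div_cancel₀ _ hc, h.mu_comm]
      _ = star (m a) * star (m c) * t (cls K (x / algebraMap (𝓞 K) K c)) *
          (m b * (m c * star (m c) * t s)) * m d := by
        simp only [mul_assoc]
      _ = _ := by
        rw [e, ← h.mu_mul, ← h.mu_mul, star_mul]
        simp only [mul_assoc]
  rw [key]
  exact star_mu_mul_mul_mu_mem_span m t _ _
    (h.theta_mul_mem_span (Submodule.subset_span ⟨_, rfl⟩) hσ)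

theorem mul_mem_span_monomials {f g : A}
    (hf : f ∈ Submodule.span ℂ {f | ∃ a b r, f = star (m a) * t r * m b})
    (hg : g ∈ Submodule.span ℂ {f | ∃ a b r, f = star (m a) * t r * m b}) :
    f * g ∈ Submodule.span ℂ {f | ∃ a b r, f = star (m a) * t r * m b} := by
  have h1 := Submodule.mul_mem_mul hf hg
  rw [Submodule.span_mul_span] at h1
  refine Submodule.span_le.2 ?_ h1
  rintro _ ⟨_, ⟨a, b, r, rfl⟩, _, ⟨c, d, s, rfl⟩, rfl⟩
  exact h.monomial_mul_monomial_mem_span a b c d r s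

theorem mu_one : m 1 = 1 := h.mu_unit 1 (by simp)

theorem mu_eq_monomial (a : (𝓞 K)⁰) : m a = star (m 1) * t 0 * m a := by
  rw [h.mu_one, h.theta_zero, star_one, one_mul, one_mul]

theorem theta_eq_monomial (r : KModO K) : t r = star (m 1) * t r * m 1 := by
  rw [h.mu_one, star_one, one_mul, mul_one]

theorem star_monomial (a b : (𝓞 K)⁰) (r : KModO K) :
    star (star (m a) * t r * m b) = star (m b) * t r * m a := by
  rw [star_mul, star_mul, star_star, h.star_theta, mul_assoc]

/-- Used with one factor the Hecke algebra, so that closure of the span of monomials can be applied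
to a graph. -/
theorem prod {B : Type*} [Ring B] [StarRing B] [Algebra ℂ B] {m' : (𝓞 K)⁰ → B}
    {t' : KModO K → B} (h' : Relations m' t') :
    Relations (fun a => (m a, m' a)) (fun r => (t r, t' r)) where
  mu_unit a ha := Prod.ext (h.mu_unit a ha) (h'.mu_unit a ha)
  star_mu_mul_mu a := Prod.ext (h.star_mu_mul_mu a) (h'.star_mu_mul_mu a)
  mu_mul a b := Prod.ext (h.mu_mul a b) (h'.mu_mul a b)
  theta_zero := Prod.ext h.theta_zero h'.theta_zero
  theta_smul r w := Prod.ext (h.theta_smul r w) (h'.theta_smul r w)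
  star_theta r := Prod.ext (h.star_theta r) (h'.star_theta r)
  theta_mul r s := by
    refine Prod.ext ((h.theta_mul r s).trans ?_) ((h'.theta_mul r s).trans ?_)
    · simp only [Prod.smul_fst, Prod.fst_sum]
    · simp only [Prod.smul_snd, Prod.snd_sum]
  mu_theta_star_mu a x := by
    refine Prod.ext ((h.mu_theta_star_mu a x).trans ?_) ((h'.mu_theta_star_mu a x).trans ?_)
    · simp only [Prod.smul_fst, Prod.fst_sum]
    · simp only [Prod.smul_snd, Prod.snd_sum]

end Relations

/-! ### The universal property. -/

section Universal

variable (K) in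
/-- The basis of the Hecke algebra that consists of the monomials. -/
noncomputable def monomialBasis : Module.Basis (monomials K) ℂ (HeckeAlgebra (PO K)) :=
  Module.Basis.mk linearIndependent_monomials (by rw [Subtype.range_coe, span_monomials])

variable {A : Type w} [Ring A] [StarRing A] [Algebra ℂ A]

/-- The linear map that takes `μ_a^* θ_r μ_b` to `(m a)^* (t r) (m b)`. -/
noncomputable def liftₗ (m : (𝓞 K)⁰ → A) (t : KModO K → A) : HeckeAlgebra (PO K) →ₗ[ℂ] A :=
  (monomialBasis K).constr ℂ fun f =>
    -- The triple representing f is an arbitrary choice; `monomial_eq_of_monomial_eq` makes it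
    -- irrelevant once the relations hold.
    star (m f.2.choose) * t f.2.choose_spec.choose_spec.choose * m f.2.choose_spec.choose

namespace Relations

variable {m : (𝓞 K)⁰ → A} {t : KModO K → A} (h : Relations m t)
include h

theorem monomial_eq_of_monomial_eq {a b a' b' : (𝓞 K)⁰} {r r' : KModO K}
    (e : star (mu a) * theta r * mu b = star (mu a') * theta r' * mu b') :
    star (m a') * t r' * m b' = star (m a) * t r * m b := by
  obtain ⟨x, rfl⟩ := cls_surjective r
  obtain ⟨x', rfl⟩ := cls_surjective r'
  refine h.monomial_congr (mem_doubleCoset_of_monomial_apply_ne_zero ?_)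
  rw [← e]
  exact monomial_apply_self_ne_zero a b x

theorem liftₗ_monomial (a b : (𝓞 K)⁰) (r : KModO K) :
    liftₗ m t (star (mu a) * theta r * mu b) = star (m a) * t r * m b := by
  have hf : star (mu a) * theta r * mu b ∈ monomials K := ⟨a, b, r, rfl⟩
  have e : star (mu a) * theta r * mu b = monomialBasis K ⟨_, hf⟩ := by
    rw [monomialBasis, Module.Basis.mk_apply]
  conv_lhs => rw [e]
  rw [liftₗ, Module.Basis.constr_basis]
  exact h.monomial_eq_of_monomial_eq hf.choose_spec.choose_spec.choose_spec

theorem liftₗ_mu (a : (𝓞 K)⁰) : liftₗ m t (mu a) = m a := by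
  rw [relations_mu_theta.mu_eq_monomial, h.liftₗ_monomial, ← h.mu_eq_monomial]

theorem liftₗ_theta (r : KModO K) : liftₗ m t (theta r) = t r := by
  rw [relations_mu_theta.theta_eq_monomial, h.liftₗ_monomial, ← h.theta_eq_monomial]

/-- Together with `span_le_graph` this identifies the graph of `liftₗ m t` with the span of the
monomials in the pairs (μ_a, m_a), (θ_r, t_r). -/
theorem mk_liftₗ_mem_span (f : HeckeAlgebra (PO K)) : (f, liftₗ m t f) ∈
    Submodule.span ℂ {f | ∃ a b r, f = star (mu a, m a) * (theta r, t r) * (mu b, m b)} := by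
  have hf : f ∈ Submodule.span ℂ (monomials K) := by
    rw [span_monomials]
    exact Submodule.mem_top
  induction hf using Submodule.span_induction with
  | mem f hf =>
    obtain ⟨a, b, r, rfl⟩ := hf
    refine Submodule.subset_span ⟨a, b, r, ?_⟩
    rw [h.liftₗ_monomial]
    rfl
  | zero =>
    rw [map_zero]
    exact Submodule.zero_mem _
  | add f g _ _ hf hg =>
    rw [map_add]
    exact Submodule.add_mem _ hf hg
  | smul c f _ hf =>
    rw [map_smul]
    exact Submodule.smul_mem _ c hf

theorem span_le_graph : Submodule.span ℂ {f | ∃ a b r,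
    f = star (mu a, m a) * (theta r, t r) * (mu b, m b)} ≤ (liftₗ m t).graph := by
  rw [Submodule.span_le]
  rintro _ ⟨a, b, r, rfl⟩
  rw [SetLike.mem_coe, LinearMap.mem_graph_iff]
  exact (h.liftₗ_monomial a b r).symm

/-- The pairs satisfy the relations in the product algebra, so the span of their monomials, which is
the graph, is closed under multiplication. -/
theorem liftₗ_mul (f g : HeckeAlgebra (PO K)) :
    liftₗ m t (f * g) = liftₗ m t f * liftₗ m t g := by
  have := h.span_le_graph ((relations_mu_theta.prod h).mul_mem_span_monomials
    (h.mk_liftₗ_mem_span f) (h.mk_liftₗ_mem_span g))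
  exact ((LinearMap.mem_graph_iff _ _).1 this).symm

theorem liftₗ_one : liftₗ m t 1 = 1 := by
  rw [← NFHecke.theta_zero (K := K), h.liftₗ_theta, h.theta_zero]

theorem liftₗ_star [StarModule ℂ A] (f : HeckeAlgebra (PO K)) :
    liftₗ m t (star f) = star (liftₗ m t f) := by
  have hf : f ∈ Submodule.span ℂ (monomials K) := by
    rw [span_monomials]
    exact Submodule.mem_top
  induction hf using Submodule.span_induction with
  | mem f hf =>
    obtain ⟨a, b, r, rfl⟩ := hf
    rw [relations_mu_theta.star_monomial, h.liftₗ_monomial, h.liftₗ_monomial, h.star_monomial]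
  | zero => simp
  | add f g _ _ hf hg => rw [star_add, map_add, map_add, star_add, hf, hg]
  | smul c f _ hf => rw [star_smul, map_smul, map_smul, star_smul, hf]

/-- The *-homomorphism from the Hecke algebra determined by a solution of the relations. -/
noncomputable def lift [StarModule ℂ A] : HeckeAlgebra (PO K) →⋆ₐ[ℂ] A :=
  { AlgHom.ofLinearMap (liftₗ m t) h.liftₗ_one h.liftₗ_mul with map_star' := h.liftₗ_star }

end Relations

theorem starAlgHom_ext {φ ψ : HeckeAlgebra (PO K) →⋆ₐ[ℂ] A}
    (hmu : ∀ a, φ (mu a) = ψ (mu a)) (htheta : ∀ r, φ (theta r) = ψ (theta r)) : φ = ψ := by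
  ext f
  have hf : f ∈ Submodule.span ℂ (monomials K) := by
    rw [span_monomials]
    exact Submodule.mem_top
  induction hf using Submodule.span_induction with
  | mem f hf =>
    obtain ⟨a, b, r, rfl⟩ := hf
    simp only [map_mul, map_star, hmu, htheta]
  | zero => rw [map_zero, map_zero]
  | add f g _ _ hf hg => rw [map_add, map_add, hf, hg]
  | smul c f _ hf => rw [map_smul, map_smul, hf]

end Universal

end NFHecke

theorem mainTheorem7 (K : Type v) [Field K] [NumberField K] :
    NFHecke.Relations (K := K) NFHecke.mu NFHecke.theta ∧
    (∀ (A : Type w) [Ring A] [StarRing A] [Algebra ℂ A] [StarModule ℂ A]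
      (m : nonZeroDivisors (𝓞 K) → A) (t : NFHecke.KModO K → A), NFHecke.Relations m t →
      ∃! φ : HeckePair.HeckeAlgebra (NFHecke.PO K) →⋆ₐ[ℂ] A,
        (∀ a, φ (NFHecke.mu a) = m a) ∧ ∀ r, φ (NFHecke.theta r) = t r) ∧
    LinearIndependent ℂ
      (Subtype.val : NFHecke.monomials K → HeckePair.HeckeAlgebra (NFHecke.PO K)) ∧
    Submodule.span ℂ (NFHecke.monomials K) = ⊤ := by
  refine ⟨NFHecke.relations_mu_theta, fun A _ _ _ _ m t h =>
    ⟨h.lift, ⟨h.liftₗ_mu, h.liftₗ_theta⟩, fun ψ hψ => ?_⟩,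
    NFHecke.linearIndependent_monomials, NFHecke.span_monomials⟩
  exact NFHecke.starAlgHom_ext (fun a => (hψ.1 a).trans (h.liftₗ_mu a).symm)
    fun r => (hψ.2 r).trans (h.liftₗ_theta r).symm
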